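/- Work in intuitionistic first-order logic without function symbols, constants or equality, over an effectively presented set $\mathcal P$ of predicate symbols with computable arities (for example a finite set). Formulas are built from atoms $P(X_1,\dots,X_n)$ and $\bot$ by $\land,\lor,\to,\forall,\exists$. A Kripke model $\mathcal M=\langle C,\le,\{\mathcal A_c\}_{c\in C}\rangle$ consists of a nonempty partially ordered set $C$ of states and structures $\mathcal A_c$ with nonempty universes $A_c$, such that $c\le c'$ implies $A_c\subseteq A_{c'}$ and $P^{\mathcal A_c}\subseteq P^{\mathcal A_{c'}}$ for every predicate $P$. The relation $c,\rho\models\varphi$ is the usual Kripke satisfaction relation, and $\mathcal M\models\varphi$ means that $c,\rho\models\varphi$ for all states $c$ and all valuations $\rho$ of the variables in $A_c$. A formula is satisfiable if it has a model, i.e. $\mathcal M\models\varphi$ for some $\mathcal M$ (for a closed formula, equivalently, if it holds at some state of some Kripke model). The model $\mathcal M$ is finite if $C$ and all $A_c$ are finite; its size is then $|C|+|\bigcup_{c\in C}A_c|$. Let $X$ be a class (set) of formulas. \begin{itemize} \item $X$ has the finite model property if every satisfiable $\tau\in X$ has a finite model. \item $X$ has the small model property if there is a function $s_X\colon X\to\mathbb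 N$, computable on $X$ (i.e. given by a partial recursive function of the Gödel number of the formula that is defined on all of $X$), such that every satisfiable $\tau\in X$ has a finite model of size $s_X(\tau)$. \item $X$ is effective if it is decidable, given a finite Kripke model (presented by finite data, with finitely many facts $P(a_1,\dots,a_n)$ at each state), whether it is a model of $X$, i.e. whether $\mathcal M\models\varphi$ for every $\varphi\in X$. \end{itemize} Proposition. An effective class $X$ of formulas has the finite model property if and only if it has the small model property. -/

import Mathlib

namespace IntFO

/-- First-order formulas without function symbols or constants over predicate symbols `P` with
arities `ar`; the variables are the natural numbers. -/
inductive Formula {P : Type} (ar : P → ℕ) : Type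
  | atom (p : P) (xs : Fin (ar p) → ℕ) : Formula ar
  | and (φ ψ : Formula ar) : Formula ar
  | or (φ ψ : Formula ar) : Formula ar
  | imp (φ ψ : Formula ar) : Formula ar
  | all (x : ℕ) (φ : Formula ar) : Formula ar
  | ex (x : ℕ) (φ : Formula ar) : Formula ar
  | bot : Formula ar

/-- The Gödel number of a formula. -/
def Formula.code {P : Type} [Primcodable P] {ar : P → ℕ} : Formula ar → ℕ
  | .bot => 0
  | .atom p xs => 6 * Nat.pair (Encodable.encode p) (Encodable.encode (List.ofFn xs)) + 1
  | .and φ ψ => 6 * Nat.pair φ.code ψ.code + 2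
  | .or φ ψ => 6 * Nat.pair φ.code ψ.code + 3
  | .imp φ ψ => 6 * Nat.pair φ.code ψ.code + 4
  | .all x φ => 6 * Nat.pair x φ.code + 5
  | .ex x φ => 6 * Nat.pair x φ.code + 6

theorem Formula.code_injective {P : Type} [Primcodable P] {ar : P → ℕ} :
    Function.Injective (Formula.code : Formula ar → ℕ) := by
  intro φ
  induction φ with
  | atom p xs =>
    intro ψ h
    cases ψ <;> simp only [Formula.code] at h <;> try omega
    rename_i q ys
    have h2 := Nat.pair_eq_pair.1 (Nat.eq_of_mul_eq_mul_left (by norm_num) (Nat.add_right_cancel h))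
    obtain rfl := Encodable.encode_injective h2.1
    rw [List.ofFn_injective (Encodable.encode_injective h2.2)]
  | and a b iha ihb | or a b iha ihb | imp a b iha ihb =>
    intro ψ h
    cases ψ <;> simp only [Formula.code] at h <;> try omega
    have h2 := Nat.pair_eq_pair.1 (Nat.eq_of_mul_eq_mul_left (by norm_num) (Nat.add_right_cancel h))
    rw [iha h2.1, ihb h2.2]
  | all x a iha | ex x a iha =>
    intro ψ h
    cases ψ <;> simp only [Formula.code] at h <;> try omega
    have h2 := Nat.pair_eq_pair.1 (Nat.eq_of_mul_eq_mul_left (by norm_num) (Nat.add_right_cancel h))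
    rw [h2.1, iha h2.2]
  | bot =>
    intro ψ h
    cases ψ <;> simp only [Formula.code] at h <;> first | rfl | omega

/-- Kripke models: a nonempty partially ordered set `C` of states and, for every state `c`, a
structure with nonempty universe `dom c` (a subset of an ambient type `D`) and relations
`rel c p` on that universe, both increasing in `c`. -/
structure KripkeModel {P : Type} (ar : P → ℕ) where
  C : Type
  C_nonempty : Nonempty C
  le : C → C → Prop
  le_refl : ∀ c, le c c
  le_trans : ∀ c d e, le c d → le d e → le c e
  le_antisymm : ∀ c d, le c d → le d c → c = d
  D : Type
  dom : C → Set D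
  dom_nonempty : ∀ c, (dom c).Nonempty
  dom_mono : ∀ c d, le c d → dom c ⊆ dom d
  rel : C → (p : P) → (Fin (ar p) → D) → Prop
  rel_dom : ∀ c p v, rel c p v → ∀ i, v i ∈ dom c
  rel_mono : ∀ c d, le c d → ∀ p v, rel c p v → rel d p v

namespace KripkeModel

variable {P : Type} {ar : P → ℕ}

/-- The satisfaction relation `c, ρ ⊨ φ`. -/
def Forces (M : KripkeModel ar) : M.C → (ℕ → M.D) → Formula ar → Prop
  | c, ρ, .atom p xs => M.rel c p fun i => ρ (xs i)
  | c, ρ, .and φ ψ => M.Forces c ρ φ ∧ M.Forces c ρ ψ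
  | c, ρ, .or φ ψ => M.Forces c ρ φ ∨ M.Forces c ρ ψ
  | c, ρ, .imp φ ψ => ∀ c', M.le c c' → M.Forces c' ρ φ → M.Forces c' ρ ψ
  | c, ρ, .all x φ => ∀ c', M.le c c' → ∀ a ∈ M.dom c', M.Forces c' (Function.update ρ x a) φ
  | c, ρ, .ex x φ => ∃ a ∈ M.dom c, M.Forces c (Function.update ρ x a) φ
  | _, _, .bot => False

/-- `M ⊨ φ`: the formula holds at every state under every valuation in the universe of that
state. -/
def Models (M : KripkeModel ar) (φ : Formula ar) : Prop :=
  ∀ c, ∀ ρ : ℕ → M.D, (∀ x, ρ x ∈ M.dom c) → M.Forces c ρ φ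

/-- `M` is a model of the class `X`. -/
def ModelsClass (M : KripkeModel ar) (X : Set (Formula ar)) : Prop :=
  ∀ φ ∈ X, M.Models φ

def IsFinite (M : KripkeModel ar) : Prop :=
  Finite M.C ∧ ∀ c, (M.dom c).Finite

/-- The size `|C| + |⋃ c, A_c|` of a model (meaningful for finite models). -/
noncomputable def size (M : KripkeModel ar) : ℕ :=
  Nat.card M.C + (⋃ c, M.dom c).ncard

end KripkeModel

section Properties

variable {P : Type} {ar : P → ℕ}

def Satisfiable (φ : Formula ar) : Prop :=
  ∃ M : KripkeModel ar, M.Models φ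

/-- The finite model property. -/
def FiniteModelProperty (X : Set (Formula ar)) : Prop :=
  ∀ τ ∈ X, Satisfiable τ → ∃ M : KripkeModel ar, M.IsFinite ∧ M.Models τ

/-- `s` is computable on `X`: some partial recursive function on Gödel numbers is defined on (the
code of) every member of `X` and yields the value of `s` there. Nothing is asked off `X`. -/
def ComputableOn [Primcodable P] (X : Set (Formula ar)) (s : Formula ar → ℕ) : Prop :=
  ∃ f : ℕ →. ℕ, Nat.Partrec f ∧ ∀ τ ∈ X, f τ.code = Part.some (s τ)

/-- The small model property. -/
def SmallModelProperty [Primcodable P] (X : Set (Formula ar)) : Prop :=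
  ∃ s : Formula ar → ℕ, ComputableOn X s ∧
    ∀ τ ∈ X, Satisfiable τ →
      ∃ M : KripkeModel ar, M.IsFinite ∧ M.size = s τ ∧ M.Models τ

end Properties

/-- Finite data describing a finite Kripke model: the number `k` of states (the states are
`0, …, k - 1`), the list of the pairs `(i, j)` with `i ≤ j`, the list of the pairs `(i, a)` with
`a` in the universe of state `i`, and the list of the facts `(i, p, [a₁, …, aₙ])` that hold at
state `i`. If there are finitely many predicates, every finite model is isomorphic to one
described in this way. -/
abbrev Presentation (P : Type) : Type :=
  ℕ × List (ℕ × ℕ) × List (ℕ × ℕ) × List (ℕ × P × List ℕ)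

namespace Presentation

variable {P : Type}

def Le (d : Presentation P) (i j : Fin d.1) : Prop := (i.1, j.1) ∈ d.2.1

def Dom (d : Presentation P) (i : Fin d.1) : Set ℕ := {a | (i.1, a) ∈ d.2.2.1}

def Rel (ar : P → ℕ) (d : Presentation P) (i : Fin d.1) (p : P) (v : Fin (ar p) → ℕ) : Prop :=
  (i.1, p, List.ofFn v) ∈ d.2.2.2

/-- The data satisfy the laws of a Kripke model. -/
structure Valid (ar : P → ℕ) (d : Presentation P) : Prop where
  pos : 0 < d.1
  le_refl : ∀ i, Le d i i
  le_trans : ∀ i j k, Le d i j → Le d j k → Le d i k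
  le_antisymm : ∀ i j, Le d i j → Le d j i → i = j
  dom_nonempty : ∀ i, (Dom d i).Nonempty
  dom_mono : ∀ i j, Le d i j → Dom d i ⊆ Dom d j
  rel_dom : ∀ i p v, Rel ar d i p v → ∀ l, v l ∈ Dom d i
  rel_mono : ∀ i j, Le d i j → ∀ p v, Rel ar d i p v → Rel ar d j p v

/-- The Kripke model described by valid data. -/
def toModel {ar : P → ℕ} (d : Presentation P) (h : Valid ar d) : KripkeModel ar where
  C := Fin d.1
  C_nonempty := ⟨⟨0, h.pos⟩⟩
  le := Le d
  le_refl := h.le_refl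
  le_trans := h.le_trans
  le_antisymm := h.le_antisymm
  D := ℕ
  dom := Dom d
  dom_nonempty := h.dom_nonempty
  dom_mono := h.dom_mono
  rel := Rel ar d
  rel_dom := h.rel_dom
  rel_mono := h.rel_mono

end Presentation

/-- A class `X` is effective if it is decidable whether given data describe a finite Kripke model
that is a model of `X`. -/
def Effective {P : Type} [Primcodable P] {ar : P → ℕ} (X : Set (Formula ar)) : Prop :=
  ComputablePred fun d : Presentation P =>
    ∃ h : Presentation.Valid ar d, (Presentation.toModel d h).ModelsClass X

end IntFO

/-! The small model property trivially implies the finite one. Conversely, suppose that every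
satisfiable formula of the class has a finite model. Then each member is either unsatisfiable or has
a finite model, and both alternatives are recursively enumerable. Searching for either kind of
certificate therefore halts on the class, and the size of the finite model found is a computable
bound, attained exactly (`FiniteModelProperty.smallModelProperty`).

For both enumerations a Kripke model whose states and elements are named by numbers is described by
a propositional valuation, a table. Being a model of the formula with code `t` amounts to local
conditions, each a finite disjunction of conjunctions of literals (`conds`, `Locally`). A table
satisfying them yields a model by a truth lemma (`IsTable.forces_iff`), and a model yields a table
once its states and elements are suitably named (`KripkeModel.locally_table`).

If every witness receives a canonical name, satisfiability becomes satisfiability of a primitive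
recursive sequence of such conditions. By compactness of Cantor space, unsatisfiability shows at a
finite stage, which is a decidable event (`exists_refuted_iff_not_satisfiable`). For a finite model
only finitely many conditions arise, so a finite list of true atoms can be checked directly
(`exists_isFiniteTable`, `IsFiniteTable.exists_model`). -/

namespace IntFO

/-! ### Primitive recursion in compositional form -/

attribute [fun_prop] Primrec
attribute [fun_prop] Primrec.const Primrec.id Primrec.comp Primrec.pair

section Primrec

variable {α β γ : Type*} [Primcodable α] [Primcodable β] [Primcodable γ]

@[fun_prop]
theorem primrec_fst_comp {f : α → β × γ} (hf : Primrec f) : Primrec fun x => (f x).1 :=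
  Primrec.fst.comp hf

@[fun_prop]
theorem primrec_snd_comp {f : α → β × γ} (hf : Primrec f) : Primrec fun x => (f x).2 :=
  Primrec.snd.comp hf

@[fun_prop]
theorem primrec_cons_comp {f : α → β} {g : α → List β} (hf : Primrec f) (hg : Primrec g) :
    Primrec fun x => f x :: g x :=
  Primrec.list_cons.comp hf hg

@[fun_prop]
theorem primrec_append_comp {f g : α → List β} (hf : Primrec f) (hg : Primrec g) :
    Primrec fun x => f x ++ g x :=
  Primrec.list_append.comp hf hg

@[fun_prop]
theorem primrec_map_comp {f : α → List β} {g : α → β → γ} (hf : Primrec f)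
    (hg : Primrec fun x : α × β => g x.1 x.2) : Primrec fun x => (f x).map (g x) :=
  Primrec.list_map hf hg

@[fun_prop]
theorem primrec_flatMap_comp {f : α → List β} {g : α → β → List γ} (hf : Primrec f)
    (hg : Primrec fun x : α × β => g x.1 x.2) : Primrec fun x => (f x).flatMap (g x) :=
  Primrec.list_flatMap hf hg

@[fun_prop]
theorem primrec_getD_comp {f : α → List β} {g : α → ℕ} {b : β} (hf : Primrec f)
    (hg : Primrec g) : Primrec fun x => (f x).getD (g x) b :=
  (Primrec.list_getD b).comp hf hg

@[fun_prop]
theorem primrec_range_comp {f : α → ℕ} (hf : Primrec f) : Primrec fun x => List.range (f x) :=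
  Primrec.list_range.comp hf

@[fun_prop]
theorem primrec_unpair_comp {f : α → ℕ} (hf : Primrec f) : Primrec fun x => (f x).unpair :=
  Primrec.unpair.comp hf

@[fun_prop]
theorem primrec_add_comp {f g : α → ℕ} (hf : Primrec f) (hg : Primrec g) :
    Primrec fun x => f x + g x :=
  Primrec.nat_add.comp hf hg

@[fun_prop]
theorem primrec_sub_comp {f g : α → ℕ} (hf : Primrec f) (hg : Primrec g) :
    Primrec fun x => f x - g x :=
  Primrec.nat_sub.comp hf hg

@[fun_prop]
theorem primrec_mul_comp {f g : α → ℕ} (hf : Primrec f) (hg : Primrec g) :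
    Primrec fun x => f x * g x :=
  Primrec.nat_mul.comp hf hg

@[fun_prop]
theorem primrec_div_comp {f g : α → ℕ} (hf : Primrec f) (hg : Primrec g) :
    Primrec fun x => f x / g x :=
  Primrec.nat_div.comp hf hg

@[fun_prop]
theorem primrec_encode_comp {f : α → β} (hf : Primrec f) :
    Primrec fun x => Encodable.encode (f x) :=
  Primrec.encode.comp hf

@[fun_prop]
theorem primrec_ofNat_comp {δ : Type*} [Denumerable δ] {f : α → ℕ} (hf : Primrec f) :
    Primrec fun x => Denumerable.ofNat δ (f x) :=
  (Primrec.ofNat δ).comp hf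

@[fun_prop]
theorem primrec_natPair_comp {f g : α → ℕ} (hf : Primrec f)
    (hg : Primrec g) : Primrec fun x => Nat.pair (f x) (g x) :=
  Primrec₂.natPair.comp hf hg

@[fun_prop]
theorem primrec_decode_getD_comp {f : α → ℕ} {b : β}
    (hf : Primrec f) : Primrec fun x => (Encodable.decode (α := β) (f x)).getD b :=
  Primrec.option_getD.comp (Primrec.decode.comp hf) (Primrec.const b)

@[fun_prop]
theorem primrec_ite_eq_comp [DecidableEq β] {f g : α → β} {u v : α → γ} (hf : Primrec f)
    (hg : Primrec g) (hu : Primrec u) (hv : Primrec v) :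
    Primrec fun x => if f x = g x then u x else v x :=
  Primrec.ite (Primrec.eq.comp hf hg) hu hv

theorem primrecPred_ball {l : α → List β} {p : α → β → Prop} (hl : Primrec l)
    (hp : PrimrecPred fun x : α × β => p x.1 x.2) : PrimrecPred fun x => ∀ y ∈ l x, p x y :=
  (PrimrecRel.forall_mem_list (R := fun y x => p x y)
    (hp.comp (Primrec.pair Primrec.snd Primrec.fst))).comp hl Primrec.id

theorem primrecPred_bex {l : α → List β} {p : α → β → Prop} (hl : Primrec l)
    (hp : PrimrecPred fun x : α × β => p x.1 x.2) : PrimrecPred fun x => ∃ y ∈ l x, p x y :=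
  (PrimrecRel.exists_mem_list (R := fun y x => p x y)
    (hp.comp (Primrec.pair Primrec.snd Primrec.fst))).comp hl Primrec.id

theorem primrecPred_mem {l : α → List β} {f : α → β} (hl : Primrec l) (hf : Primrec f) :
    PrimrecPred fun x => f x ∈ l x :=
  (primrecPred_bex (p := fun x y => y = f x) hl
    (Primrec.eq.comp Primrec.snd (hf.comp Primrec.fst))).of_eq fun x => by simp

end Primrec

/-- All lists of length `n` with entries below `b`. -/
def allLists (n b : ℕ) : List (List ℕ) :=
  Nat.rec [[]] (fun _ ls => ls.flatMap fun l => (List.range b).map fun y => y :: l) n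

theorem mem_allLists {n b : ℕ} {l : List ℕ} :
    l ∈ allLists n b ↔ l.length = n ∧ ∀ y ∈ l, y < b := by
  induction n generalizing l with
  | zero => cases l <;> simp [allLists]
  | succ n ih =>
    have h : allLists (n + 1) b =
        (allLists n b).flatMap fun l => (List.range b).map fun y => y :: l := rfl
    rw [h]
    cases l with
    | nil => simp
    | cons z l =>
      simp only [List.mem_flatMap, List.mem_map, List.mem_range, List.cons.injEq,
        List.length_cons, Nat.add_right_cancel_iff, List.mem_cons, forall_eq_or_imp]
      constructor
      · rintro ⟨l', hl', y, hy, rfl, rfl⟩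
        exact ⟨(ih.1 hl').1, hy, (ih.1 hl').2⟩
      · rintro ⟨h1, h2, h3⟩
        exact ⟨l, ih.2 ⟨h1, h3⟩, z, h2, rfl, rfl⟩

@[fun_prop]
theorem primrec_allLists_comp {α : Type*} [Primcodable α] {f g : α → ℕ} (hf : Primrec f)
    (hg : Primrec g) : Primrec fun x => allLists (f x) (g x) := by
  refine Primrec.nat_rec' (h := fun x p => p.2.flatMap fun l =>
    (List.range (g x)).map fun y => y :: l) hf (Primrec.const [[]]) ?_
  change Primrec fun z : α × ℕ × List (List ℕ) => _
  fun_prop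

/-! ### Propositional compactness, effectively -/

section Compactness

variable {α β : Type*}

/-- A disjunction of conjunctions of literals holds under the valuation `V`. -/
def Sat (V : α → Bool) (δ : List (List (α × Bool))) : Prop :=
  ∃ γ ∈ δ, ∀ l ∈ γ, V l.1 = l.2

theorem isClosed_sat (δ : List (List (α × Bool))) : IsClosed {V : α → Bool | Sat V δ} := by
  have h : {V : α → Bool | Sat V δ} =
      ⋃ γ ∈ {γ | γ ∈ δ}, ⋂ l ∈ {l | l ∈ γ}, {V : α → Bool | V l.1 = l.2} := by
    ext V; simp [Sat]
  rw [h]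
  refine (List.finite_toSet δ).isClosed_biUnion fun γ _ => isClosed_biInter fun l _ => ?_
  exact isClosed_eq (continuous_apply l.1) continuous_const

/-- Each condition mentions finitely many atoms, hence is closed in the compact space of valuations.
If all finite stages were satisfiable, the decreasing nonempty closed sets they define would have a
common point. -/
theorem exists_forall_lt_not_sat {cl : ℕ → List (List (α × Bool))}
    (h : ¬∃ V : α → Bool, ∀ i, Sat V (cl i)) : ∃ n, ∀ V : α → Bool, ∃ i < n, ¬Sat V (cl i) := by
  by_contra! hn
  have hcl : ∀ n, IsClosed {V : α → Bool | ∀ i < n, Sat V (cl i)} := by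
    intro n
    have : {V : α → Bool | ∀ i < n, Sat V (cl i)} = ⋂ i, ⋂ (_ : i < n), {V | Sat V (cl i)} := by
      ext; simp
    rw [this]
    exact isClosed_iInter fun i => isClosed_iInter fun _ => isClosed_sat _
  obtain ⟨V, hV⟩ := IsCompact.nonempty_iInter_of_sequence_nonempty_isCompact_isClosed
    (fun n => {V : α → Bool | ∀ i < n, Sat V (cl i)}) (fun n V hV i hi => hV i (by omega)) hn
    (hcl 0).isCompact hcl
  exact h ⟨V, fun i => Set.mem_iInter.1 hV (i + 1) i (by omega)⟩

variable [Primcodable α]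

/-- The bits `w` on the atoms with code below `n` already falsify some `cl b i` with `i < n`. -/
def Refuted (cl : β → ℕ → List (List (α × Bool))) (b : β) (n : ℕ) (w : List ℕ) : Prop :=
  ∃ i ∈ List.range n, ∀ γ ∈ cl b i, ∃ l ∈ γ, Encodable.encode l.1 ∈ List.range n ∧
    ¬ (if w.getD (Encodable.encode l.1) 0 = 1 then true else false) = l.2

theorem primrecPred_refuted [Primcodable β] {cl : β → ℕ → List (List (α × Bool))}
    (hcl : Primrec fun x : β × ℕ => cl x.1 x.2) :
    PrimrecPred fun x : β × ℕ => ∀ w ∈ allLists x.2 2, Refuted cl x.1 x.2 w := by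
  have hcl' : ∀ {δ : Type _} [Primcodable δ] {f : δ → β} {g : δ → ℕ}, Primrec f → Primrec g →
      Primrec fun x => cl (f x) (g x) := fun hf hg => hcl.comp (hf.pair hg)
  refine primrecPred_ball (by fun_prop) (primrecPred_bex (by fun_prop) (primrecPred_ball
    (hcl' (by fun_prop) (by fun_prop)) (primrecPred_bex (by fun_prop) (PrimrecPred.and
      (primrecPred_mem (by fun_prop) (by fun_prop))
      (PrimrecPred.not (Primrec.eq.comp (by fun_prop) (by fun_prop)))))))

/-- The stage `n` bounds both the conditions inspected and the codes of the atoms whose bits are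
known. Compactness bounds the conditions needed, these mention only finitely many atoms, and the
larger of the two bounds serves. -/
theorem exists_refuted_iff (cl : β → ℕ → List (List (α × Bool))) (b : β) :
    (∃ n, ∀ w ∈ allLists n 2, Refuted cl b n w) ↔ ¬∃ V : α → Bool, ∀ i, Sat V (cl b i) := by
  constructor
  · rintro ⟨n, hn⟩ ⟨V, hV⟩
    -- Numbers that code no atom receive the bit 0.
    let U : ℕ → ℕ := fun j => ((Encodable.decode (α := α) j).elim 0 fun x => (V x).toNat)
    obtain ⟨i, -, hi⟩ := hn ((List.range n).map U) (mem_allLists.2 ⟨by simp, by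
      intro y hy
      obtain ⟨j, -, rfl⟩ := List.mem_map.1 hy
      simp only [U]
      cases Encodable.decode (α := α) j with
      | none => simp
      | some x => simpa using Nat.lt_succ_of_le (Bool.toNat_le (V x))⟩)
    obtain ⟨γ, hγ, h⟩ := hV i
    obtain ⟨l, hl, hlt, hne⟩ := hi γ hγ
    apply hne
    rw [← h l hl, List.getD_eq_getElem _ _ (by simpa using hlt)]
    simp [U]
  · intro h
    obtain ⟨n, hn⟩ := exists_forall_lt_not_sat h
    obtain ⟨m, hm⟩ : ∃ m, ∀ i < n, ∀ γ ∈ cl b i, ∀ l ∈ γ, Encodable.encode l.1 < m := by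
      have hfin : (⋃ i ∈ {i | i < n}, ⋃ γ ∈ {γ | γ ∈ cl b i},
          ⋃ l ∈ {l | l ∈ γ}, {Encodable.encode l.1}).Finite :=
        (Set.finite_lt_nat n).biUnion fun i _ => (List.finite_toSet _).biUnion fun γ _ =>
          (List.finite_toSet _).biUnion fun l _ => Set.finite_singleton _
      obtain ⟨m, hm⟩ := hfin.bddAbove
      refine ⟨m + 1, fun i hi γ hγ l hl => Nat.lt_succ_of_le (hm ?_)⟩
      simp only [Set.mem_iUnion, Set.mem_ofPred_eq, Set.mem_singleton_iff]
      exact ⟨i, hi, γ, hγ, l, hl, rfl⟩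
    refine ⟨max n m, fun w _ => ?_⟩
    obtain ⟨i, hi, hns⟩ := hn fun x => if w.getD (Encodable.encode x) 0 = 1 then true else false
    refine ⟨i, List.mem_range.2 (by omega), fun γ hγ => ?_⟩
    by_contra! hc
    refine hns ⟨γ, hγ, fun l hl => ?_⟩
    exact hc l hl (List.mem_range.2 (lt_of_lt_of_le (hm i hi γ hγ l hl) (le_max_right _ _)))

end Compactness

open Encodable

/-! ### Local conditions on tables describing Kripke models -/

/-- Propositional atoms describing a Kripke model with states and elements named by numbers. -/
abbrev Atom : Type := ℕ × ℕ × ℕ × List ℕ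

namespace Atom

/-- `k` is the code of a relevant formula. -/
abbrev isCode (k : ℕ) : Atom := (0, k, 0, [])

/-- State `c` is below state `d`. -/
abbrev le (c d : ℕ) : Atom := (1, c, d, [])

/-- Element `a` lies in the universe of state `c`. -/
abbrev dom (c a : ℕ) : Atom := (2, c, a, [])

/-- The predicate with code `p` holds of the tuple `v` at state `c`. -/
abbrev rel (c p : ℕ) (v : List ℕ) : Atom := (3, c, p, v)

/-- The formula with code `k` is forced at state `c` under the valuation `r`. -/
abbrev forces (c : ℕ) (r : List ℕ) (k : ℕ) : Atom := (4, c, k, r)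

end Atom

/-- The valuation `r`, restricted to the variables below `n`, with `x` sent to `a`. -/
def updateList (n : ℕ) (r : List ℕ) (x a : ℕ) : List ℕ :=
  (List.range n).map fun y => if y = x then a else r.getD y 0

@[fun_prop]
theorem primrec_updateList_comp {α : Type*} [Primcodable α] {n x a : α → ℕ} {r : α → List ℕ}
    (hn : Primrec n) (hr : Primrec r) (hx : Primrec x) (ha : Primrec a) :
    Primrec fun z => updateList (n z) (r z) (x z) (a z) := by
  unfold updateList
  fun_prop

theorem getD_updateList {n : ℕ} {r : List ℕ} {x a y : ℕ} (hy : y < n) :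
    (updateList n r x a).getD y 0 = if y = x then a else r.getD y 0 := by
  rw [updateList, List.getD_eq_getElem _ _ (by simpa using hy)]
  simp

/-- The values of the variables listed in `l` under the valuation `r`. -/
def values (r : List ℕ) (l : ℕ) : List ℕ :=
  (Denumerable.ofNat (List ℕ) l).map fun x => r.getD x 0

@[fun_prop]
theorem primrec_values_comp {α : Type*} [Primcodable α] {l : α → ℕ} {r : α → List ℕ}
    (hr : Primrec r) (hl : Primrec l) : Primrec fun z => values (r z) (l z) := by
  unfold values
  fun_prop

/-- The first component of a compound code. -/
def leftCode (k : ℕ) : ℕ := ((k - 1) / 6).unpair.1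

/-- The second component of a compound code. -/
def rightCode (k : ℕ) : ℕ := ((k - 1) / 6).unpair.2

@[fun_prop]
theorem primrec_leftCode_comp {α : Type*} [Primcodable α] {k : α → ℕ} (hk : Primrec k) :
    Primrec fun z => leftCode (k z) := by
  unfold leftCode
  fun_prop

@[fun_prop]
theorem primrec_rightCode_comp {α : Type*} [Primcodable α] {k : α → ℕ} (hk : Primrec k) :
    Primrec fun z => rightCode (k z) := by
  unfold rightCode
  fun_prop

/-- The disjunction `δ` if `k` is a compound code with tag `j`, a tautology otherwise. -/
def ifTag (j k : ℕ) (δ : List (List (Atom × Bool))) : List (List (Atom × Bool)) :=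
  if k = 6 * ((k - 1) / 6) + j then δ else [[]]

@[fun_prop]
theorem primrec_ifTag_comp {α : Type*} [Primcodable α] {j k : α → ℕ}
    {δ : α → List (List (Atom × Bool))} (hj : Primrec j) (hk : Primrec k) (hδ : Primrec δ) :
    Primrec fun z => ifTag (j z) (k z) (δ z) := by
  unfold ifTag
  fun_prop

open Atom in
/-- The conditions, each a disjunction of conjunctions of literals, that a table must satisfy at
the states `c d e`, the element `a`, the valuation `r` and the code `k` in order to describe a
model of the formula with code `t`; witnesses are sought among the states `sc` and the
elements `ec`. -/
def conds (t : ℕ) (sc ec : List ℕ) (c d e a : ℕ) (r : List ℕ) (k : ℕ) :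
    List (List (List (Atom × Bool))) :=
  let u := leftCode k
  let v := rightCode k
  let n := t + 1
  [ [[(isCode t, true)]],
    [[(le c c, true)]],
    [[(le c d, false)], [(le d e, false)], [(le c e, true)]],
    -- Distinct numbers must name distinct states, so antisymmetry refers to equality of names.
    if c = d then [[]] else [[(le c d, false)], [(le d c, false)]],
    ec.map fun b => [(dom c b, true)],
    [[(le c d, false)], [(dom c a, false)], [(dom d a, true)]],
    (List.range n).map (fun x => [(dom c (r.getD x 0), false)]) ++ [[(forces c r t, true)]],
    ifTag 1 k [[(isCode k, false)], [(le c d, false)], [(rel c u (values r v), false)],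
      [(rel d u (values r v), true)]],
    ifTag 1 k [[(isCode k, false)],
      [(forces c r k, true), (rel c u (values r v), true)],
      [(forces c r k, false), (rel c u (values r v), false)]],
    ifTag 1 k [[(isCode k, false)], [(rel c u (values r v), false)],
      (values r v).map fun b => (dom c b, true)],
    -- The table itself says which codes are relevant: `t` is, and relevance passes to subformulas.
    -- The conditions thus never have to decide whether a number codes a formula.
    ifTag 2 k [[(isCode k, false)], [(isCode u, true), (isCode v, true)]],
    ifTag 2 k [[(isCode k, false)],
      [(forces c r k, true), (forces c r u, true), (forces c r v, true)],
      [(forces c r k, false), (forces c r u, false)],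
      [(forces c r k, false), (forces c r v, false)]],
    ifTag 3 k [[(isCode k, false)], [(isCode u, true), (isCode v, true)]],
    ifTag 3 k [[(isCode k, false)],
      [(forces c r k, false), (forces c r u, false), (forces c r v, false)],
      [(forces c r k, true), (forces c r u, true)],
      [(forces c r k, true), (forces c r v, true)]],
    ifTag 4 k [[(isCode k, false)], [(isCode u, true), (isCode v, true)]],
    ifTag 4 k [[(isCode k, false)], [(forces c r k, false)], [(le c d, false)],
      [(forces d r u, false)], [(forces d r v, true)]],
    ifTag 4 k ([[(isCode k, false)], [(forces c r k, true)]] ++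
      sc.map fun w => [(le c w, true), (forces w r u, true), (forces w r v, false)]),
    ifTag 5 k [[(isCode k, false)], [(isCode v, true)]],
    ifTag 5 k [[(isCode k, false)], [(forces c r k, false)], [(le c d, false)],
      [(dom d a, false)], [(forces d (updateList n r u a) v, true)]],
    ifTag 5 k ([[(isCode k, false)], [(forces c r k, true)]] ++ sc.flatMap fun w => ec.map fun b =>
      [(le c w, true), (dom w b, true), (forces w (updateList n r u b) v, false)]),
    ifTag 6 k [[(isCode k, false)], [(isCode v, true)]],
    ifTag 6 k [[(isCode k, false)], [(forces c r k, true)], [(dom c a, false)],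
      [(forces c (updateList n r u a) v, false)]],
    ifTag 6 k ([[(isCode k, false)], [(forces c r k, false)]] ++
      ec.map fun b => [(dom c b, true), (forces c (updateList n r u b) v, true)]),
    -- 0 is the code of falsity.
    [[(forces c r 0, false)]] ]

@[fun_prop]
theorem primrec_conds_comp {α : Type*} [Primcodable α] {t c d e a k : α → ℕ}
    {sc ec r : α → List ℕ} (ht : Primrec t) (hsc : Primrec sc) (hec : Primrec ec)
    (hc : Primrec c) (hd : Primrec d) (he : Primrec e) (ha : Primrec a) (hr : Primrec r)
    (hk : Primrec k) :
    Primrec fun z => conds (t z) (sc z) (ec z) (c z) (d z) (e z) (a z) (r z) (k z) := by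
  unfold conds
  fun_prop

open Atom in
/-- The meaning of `conds`. -/
structure Locally (V : Atom → Bool) (t : ℕ) (sc ec : List ℕ) (c d e a : ℕ) (r : List ℕ) (k : ℕ) :
    Prop where
  isCode_root : V (isCode t)
  le_refl : V (le c c)
  le_trans : V (le c d) → V (le d e) → V (le c e)
  le_antisymm : V (le c d) → V (le d c) → c = d
  dom_nonempty : ∃ b ∈ ec, V (dom c b)
  dom_mono : V (le c d) → V (dom c a) → V (dom d a)
  root : (∀ x < t + 1, V (dom c (r.getD x 0))) → V (forces c r t)
  rel_mono : ∀ u v, k = 6 * Nat.pair u v + 1 → V (isCode k) → V (le c d) →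
    V (rel c u (values r v)) → V (rel d u (values r v))
  atom : ∀ u v, k = 6 * Nat.pair u v + 1 → V (isCode k) →
    (V (forces c r k) ↔ V (rel c u (values r v)))
  rel_dom : ∀ u v, k = 6 * Nat.pair u v + 1 → V (isCode k) → V (rel c u (values r v)) →
    ∀ b ∈ values r v, V (dom c b)
  isCode_and : ∀ u v, k = 6 * Nat.pair u v + 2 → V (isCode k) → V (isCode u) ∧ V (isCode v)
  and : ∀ u v, k = 6 * Nat.pair u v + 2 → V (isCode k) →
    (V (forces c r k) ↔ V (forces c r u) ∧ V (forces c r v))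
  isCode_or : ∀ u v, k = 6 * Nat.pair u v + 3 → V (isCode k) → V (isCode u) ∧ V (isCode v)
  or : ∀ u v, k = 6 * Nat.pair u v + 3 → V (isCode k) →
    (V (forces c r k) ↔ V (forces c r u) ∨ V (forces c r v))
  isCode_imp : ∀ u v, k = 6 * Nat.pair u v + 4 → V (isCode k) → V (isCode u) ∧ V (isCode v)
  imp : ∀ u v, k = 6 * Nat.pair u v + 4 → V (isCode k) → V (forces c r k) → V (le c d) →
    V (forces d r u) → V (forces d r v)
  not_imp : ∀ u v, k = 6 * Nat.pair u v + 4 → V (isCode k) → ¬V (forces c r k) →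
    ∃ w ∈ sc, V (le c w) ∧ V (forces w r u) ∧ ¬V (forces w r v)
  isCode_all : ∀ u v, k = 6 * Nat.pair u v + 5 → V (isCode k) → V (isCode v)
  all : ∀ u v, k = 6 * Nat.pair u v + 5 → V (isCode k) → V (forces c r k) → V (le c d) →
    V (dom d a) → V (forces d (updateList (t + 1) r u a) v)
  not_all : ∀ u v, k = 6 * Nat.pair u v + 5 → V (isCode k) → ¬V (forces c r k) →
    ∃ w ∈ sc, ∃ b ∈ ec, V (le c w) ∧ V (dom w b) ∧ ¬V (forces w (updateList (t + 1) r u b) v)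
  isCode_ex : ∀ u v, k = 6 * Nat.pair u v + 6 → V (isCode k) → V (isCode v)
  not_ex : ∀ u v, k = 6 * Nat.pair u v + 6 → V (isCode k) → ¬V (forces c r k) → V (dom c a) →
    ¬V (forces c (updateList (t + 1) r u a) v)
  ex : ∀ u v, k = 6 * Nat.pair u v + 6 → V (isCode k) → V (forces c r k) →
    ∃ b ∈ ec, V (dom c b) ∧ V (forces c (updateList (t + 1) r u b) v)
  bot : ¬V (forces c r 0)

section Sat

variable {α : Type*} {V : α → Bool}

theorem sat_nil : ¬Sat V [] := by simp [Sat]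

theorem sat_cons {γ : List (α × Bool)} {δ : List (List (α × Bool))} :
    Sat V (γ :: δ) ↔ (∀ l ∈ γ, V l.1 = l.2) ∨ Sat V δ := by simp [Sat]

theorem sat_append {δ ε : List (List (α × Bool))} :
    Sat V (δ ++ ε) ↔ Sat V δ ∨ Sat V ε := by
  simp [Sat, or_and_right, exists_or]

theorem sat_map {β : Type*} {s : List β} {f : β → List (α × Bool)} :
    Sat V (s.map f) ↔ ∃ w ∈ s, ∀ l ∈ f w, V l.1 = l.2 := by
  simp [Sat]

theorem sat_flatMap {β : Type*} {s : List β} {f : β → List (List (α × Bool))} :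
    Sat V (s.flatMap f) ↔ ∃ w ∈ s, Sat V (f w) := by
  simp only [Sat, List.mem_flatMap]
  grind

theorem sat_ite {p : Prop} [Decidable p] {δ : List (List (α × Bool))} :
    Sat V (if p then δ else [[]]) ↔ (p → Sat V δ) := by
  split <;> simp_all [Sat]

theorem sat_ite_not {p : Prop} [Decidable p] {δ : List (List (α × Bool))} :
    Sat V (if p then [[]] else δ) ↔ (¬p → Sat V δ) := by
  split <;> simp_all [Sat]

end Sat

theorem leftCode_eq {u v j : ℕ} (hj : 1 ≤ j) (hj' : j ≤ 6) :
    leftCode (6 * Nat.pair u v + j) = u := by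
  rw [leftCode, show (6 * Nat.pair u v + j - 1) / 6 = Nat.pair u v by omega, Nat.unpair_pair]

theorem rightCode_eq {u v j : ℕ} (hj : 1 ≤ j) (hj' : j ≤ 6) :
    rightCode (6 * Nat.pair u v + j) = v := by
  rw [rightCode, show (6 * Nat.pair u v + j - 1) / 6 = Nat.pair u v by omega, Nat.unpair_pair]

/-- Pairing is a bijection and the tags 1 to 6 are the residues of `k - 1` modulo 6, shifted by one.
So `k` determines its components, and the unbounded quantifiers reduce to one computable instance.
-/
theorem forall_tag_iff {P : ℕ → ℕ → Prop} {j k : ℕ} (hj : 1 ≤ j) (hj' : j ≤ 6) :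
    (∀ u v, k = 6 * Nat.pair u v + j → P u v) ↔
      (k = 6 * ((k - 1) / 6) + j → P (leftCode k) (rightCode k)) := by
  constructor
  · intro h hk
    exact h _ _ (by rw [leftCode, rightCode, Nat.pair_unpair]; exact hk)
  · rintro h u v rfl
    rw [leftCode_eq hj hj', rightCode_eq hj hj'] at h
    exact h (by omega)

theorem forall_conds_sat_iff {V : Atom → Bool} {t : ℕ} {sc ec : List ℕ} {c d e a : ℕ}
    {r : List ℕ} {k : ℕ} :
    (∀ δ ∈ conds t sc ec c d e a r k, Sat V δ) ↔ Locally V t sc ec c d e a r k := by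
  simp only [conds, List.forall_mem_cons, List.not_mem_nil, false_imp_iff, implies_true, and_true,
    ifTag, sat_ite, sat_ite_not, sat_cons, sat_append, sat_map, sat_flatMap, sat_nil, or_false,
    List.forall_mem_map, List.mem_range, ← Bool.not_eq_true]
  constructor
  · rintro ⟨h1, h2, h3, h4, h5, h6, h7, h8, h9, h10, h11, h12, h13, h14, h15, h16, h17, h18, h19,
      h20, h21, h22, h23, h24⟩
    constructor <;> (try rw [forall_tag_iff (by norm_num) (by norm_num)]) <;> grind
  · rintro ⟨h1, h2, h3, h4, h5, h6, h7, h8, h9, h10, h11, h12, h13, h14, h15, h16, h17, h18, h19,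
      h20, h21, h22, h23, h24⟩
    rw [forall_tag_iff (by norm_num) (by norm_num)] at h8 h9 h10 h11 h12 h13 h14 h15
    rw [forall_tag_iff (by norm_num) (by norm_num)] at h16 h17 h18 h19 h20 h21 h22 h23
    refine ⟨?_, ?_, ?_, ?_, ?_, ?_, ?_, ?_, ?_, ?_, ?_, ?_, ?_, ?_, ?_, ?_, ?_, ?_, ?_, ?_, ?_, ?_,
      ?_, ?_⟩ <;> grind

/-! ### From tables to models -/

theorem le_encode_of_mem {l : List ℕ} {x : ℕ} (h : x ∈ l) : x ≤ encode l := by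
  induction l with
  | nil => simp at h
  | cons y l ih =>
    rw [encode_list_cons]
    rcases List.mem_cons.1 h with rfl | h
    · exact (Nat.left_le_pair _ _).trans (Nat.le_succ _)
    · exact ((ih h).trans (Nat.right_le_pair _ _)).trans (Nat.le_succ _)

theorem getD_le_encode (l : List ℕ) (x : ℕ) : l.getD x 0 ≤ encode l := by
  by_cases h : x < l.length
  · rw [List.getD_eq_getElem _ _ h]
    exact le_encode_of_mem (List.getElem_mem h)
  · rw [List.getD_eq_default _ _ (by omega)]
    exact Nat.zero_le _

section Vars

variable {P : Type} {ar : P → ℕ}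

/-- All variables of the formula, free or bound, are below `n`. -/
def Formula.VarsBelow (n : ℕ) : Formula ar → Prop
  | .atom _ xs => ∀ i, xs i < n
  | .and φ ψ => φ.VarsBelow n ∧ ψ.VarsBelow n
  | .or φ ψ => φ.VarsBelow n ∧ ψ.VarsBelow n
  | .imp φ ψ => φ.VarsBelow n ∧ ψ.VarsBelow n
  | .all x φ => x < n ∧ φ.VarsBelow n
  | .ex x φ => x < n ∧ φ.VarsBelow n
  | .bot => True

/-- Pairing dominates both components, so a code bounds every variable occurring in its formula.
This is why valuations only need to be recorded below `t + 1`. -/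
theorem Formula.varsBelow_of_code_lt [Primcodable P] {n : ℕ} {φ : Formula ar} (h : φ.code < n) :
    φ.VarsBelow n := by
  induction φ with
  | atom p xs =>
    intro i
    have h1 : xs i ≤ encode (List.ofFn xs) := le_encode_of_mem (by simp)
    have h2 := Nat.right_le_pair (encode p) (encode (List.ofFn xs))
    simp only [Formula.code] at h
    omega
  | and a b iha ihb | or a b iha ihb | imp a b iha ihb =>
    have h1 := Nat.left_le_pair a.code b.code
    have h2 := Nat.right_le_pair a.code b.code
    simp only [Formula.code] at h
    exact ⟨iha (by omega), ihb (by omega)⟩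
  | all x a iha | ex x a iha =>
    have h1 := Nat.left_le_pair x a.code
    have h2 := Nat.right_le_pair x a.code
    simp only [Formula.code] at h
    exact ⟨by omega, iha (by omega)⟩
  | bot => trivial

theorem update_agree {D : Type} {n x : ℕ} {a : D} {ρ ρ' : ℕ → D} (h : ∀ y < n, ρ y = ρ' y) :
    ∀ y < n, Function.update ρ x a y = Function.update ρ' x a y := by
  intro y hy
  simp only [Function.update_apply, h y hy]

theorem forces_congr (M : KripkeModel ar) {n : ℕ} {φ : Formula ar} (hφ : φ.VarsBelow n) {c : M.C}
    {ρ ρ' : ℕ → M.D} (h : ∀ x < n, ρ x = ρ' x) : M.Forces c ρ φ ↔ M.Forces c ρ' φ := by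
  induction φ generalizing c ρ ρ' with
  | atom p xs =>
    have : (fun i => ρ (xs i)) = fun i => ρ' (xs i) := funext fun i => h _ (hφ i)
    simp only [KripkeModel.Forces, this]
  | and φ ψ ih ih' | or φ ψ ih ih' | imp φ ψ ih ih' =>
    simp only [KripkeModel.Forces, ih hφ.1 h, ih' hφ.2 h]
  | all x φ ih | ex x φ ih =>
    simp only [KripkeModel.Forces, ih hφ.2 (update_agree h)]
  | bot => rfl

end Vars

/-- The valuation `V` describes a model of the formula with code `t`, with states `S`, elements `A`
and valuations `Q`. -/
structure IsTable (V : Atom → Bool) (t : ℕ) (S A : Set ℕ) (Q : Set (List ℕ)) : Prop where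
  states_nonempty : S.Nonempty
  elements_nonempty : A.Nonempty
  valuations_nonempty : Q.Nonempty
  update : ∀ r ∈ Q, ∀ x, ∀ a ∈ A, updateList (t + 1) r x a ∈ Q
  getD_mem : ∀ r ∈ Q, ∀ x < t + 1, r.getD x 0 ∈ A
  -- The witness lists may depend on the instance: this covers one canonical witness per instance as
  -- well as a fixed list of all states and elements.
  local_conds : ∀ c ∈ S, ∀ d ∈ S, ∀ e ∈ S, ∀ a ∈ A, ∀ r ∈ Q, ∀ k ≤ t, ∃ sc ec : List ℕ,
    (∀ w ∈ sc, w ∈ S) ∧ (∀ b ∈ ec, b ∈ A) ∧ Locally V t sc ec c d e a r k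

namespace IsTable

variable {V : Atom → Bool} {t : ℕ} {S A : Set ℕ} {Q : Set (List ℕ)}

/-- The set `Q` is only known to be closed under single updates, so the valuation is assembled one
variable at a time. -/
theorem exists_agree (h : IsTable V t S A Q) (ρ : ℕ → ℕ) (hρ : ∀ x, ρ x ∈ A) :
    ∃ r ∈ Q, ∀ x < t + 1, r.getD x 0 = ρ x := by
  have key : ∀ j, ∃ r ∈ Q, ∀ x < t + 1, x < j → r.getD x 0 = ρ x := by
    intro j
    induction j with
    | zero =>
      obtain ⟨r, hr⟩ := h.valuations_nonempty
      exact ⟨r, hr, fun x _ hx => absurd hx (by omega)⟩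
    | succ j ih =>
      obtain ⟨r, hr, hj⟩ := ih
      refine ⟨_, h.update r hr j (ρ j) (hρ j), fun x hx hxj => ?_⟩
      rw [getD_updateList hx]
      split
      · subst_vars; rfl
      · exact hj x hx (by omega)
  obtain ⟨r, hr, hj⟩ := key (t + 1)
  exact ⟨r, hr, fun x hx => hj x hx hx⟩

theorem frame (h : IsTable V t S A Q) {c d e a : ℕ} (hc : c ∈ S) (hd : d ∈ S) (he : e ∈ S)
    (ha : a ∈ A) : ∃ sc ec : List ℕ, ∃ r k, (∀ b ∈ ec, b ∈ A) ∧ Locally V t sc ec c d e a r k := by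
  obtain ⟨r, hr⟩ := h.valuations_nonempty
  obtain ⟨sc, ec, -, hec, hl⟩ := h.local_conds c hc d hd e he a ha r hr 0 (Nat.zero_le _)
  exact ⟨sc, ec, r, 0, hec, hl⟩

variable {P : Type} [Primcodable P]

/-- The Kripke model described by a table. -/
def toModel (ar : P → ℕ) (h : IsTable V t S A Q) : KripkeModel ar where
  C := S
  C_nonempty := h.states_nonempty.to_subtype
  le c d := V (.le c d)
  le_refl c := by
    obtain ⟨a, ha⟩ := h.elements_nonempty
    obtain ⟨sc, ec, r, k, -, hl⟩ := h.frame c.2 c.2 c.2 ha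
    exact hl.le_refl
  le_trans c d e := by
    obtain ⟨a, ha⟩ := h.elements_nonempty
    obtain ⟨sc, ec, r, k, -, hl⟩ := h.frame c.2 d.2 e.2 ha
    exact hl.le_trans
  le_antisymm c d h1 h2 := by
    obtain ⟨a, ha⟩ := h.elements_nonempty
    obtain ⟨sc, ec, r, k, -, hl⟩ := h.frame c.2 d.2 d.2 ha
    exact Subtype.ext (hl.le_antisymm h1 h2)
  D := ℕ
  dom c := {a | a ∈ A ∧ V (.dom c a)}
  dom_nonempty c := by
    obtain ⟨a, ha⟩ := h.elements_nonempty
    obtain ⟨sc, ec, r, k, hec, hl⟩ := h.frame c.2 c.2 c.2 ha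
    obtain ⟨b, hb, hb'⟩ := hl.dom_nonempty
    exact ⟨b, hec b hb, hb'⟩
  dom_mono c d hcd a ha := by
    obtain ⟨sc, ec, r, k, -, hl⟩ := h.frame c.2 d.2 d.2 ha.1
    exact ⟨ha.1, hl.dom_mono hcd ha.2⟩
  -- The table is constrained only on tuples arising from relevant atomic formulas. Restricting to
  -- tuples in the universe and closing upwards makes the laws hold for all tuples, and changes
  -- nothing on the constrained ones.
  rel c p v := ∃ c' ∈ S, V (.le c' c) ∧ V (.rel c' (encode p) (List.ofFn v)) ∧
    ∀ i, v i ∈ A ∧ V (.dom c' (v i))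
  rel_dom c p v := by
    rintro ⟨c', hc', hle, -, hv⟩ i
    obtain ⟨sc, ec, r, k, -, hl⟩ := h.frame hc' c.2 c.2 (hv i).1
    exact ⟨(hv i).1, hl.dom_mono hle (hv i).2⟩
  rel_mono c d hcd p v := by
    rintro ⟨c', hc', hle, hr, hv⟩
    obtain ⟨a, ha⟩ := h.elements_nonempty
    obtain ⟨sc, ec, r, k, -, hl⟩ := h.frame hc' c.2 d.2 ha
    exact ⟨c', hc', hl.le_trans hle hcd, hr, hv⟩

variable {ar : P → ℕ}

theorem agree_update {ρ : ℕ → ℕ} {r : List ℕ} {n x a : ℕ} (hρ : ∀ y < n, r.getD y 0 = ρ y) :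
    ∀ y < n, (updateList n r x a).getD y 0 = Function.update ρ x a y := by
  intro y hy
  rw [getD_updateList hy, Function.update_apply, hρ y hy]

/-- The truth lemma, by induction on the formula. Counterexamples and witnesses come from `not_imp`,
`not_all` and `ex`; they belong to the model because the witness lists stay inside `S` and `A`. -/
theorem forces_iff (h : IsTable V t S A Q) {φ : Formula ar} (hφ : φ.VarsBelow (t + 1))
    (hcode : V (.isCode φ.code)) (hle : φ.code ≤ t) {c : S} {r : List ℕ} (hr : r ∈ Q)
    {ρ : ℕ → ℕ} (hρ : ∀ x < t + 1, r.getD x 0 = ρ x) :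
    V (.forces c r φ.code) ↔ (h.toModel ar).Forces c ρ φ := by
  -- A dummy argument for the local conditions that involve no element.
  obtain ⟨a₀, ha₀⟩ := h.elements_nonempty
  induction φ generalizing c r ρ with
  | atom p xs =>
    have hv : values r (encode (List.ofFn xs)) = List.ofFn fun i => ρ (xs i) := by
      rw [values, Denumerable.ofNat_encode, List.map_ofFn]
      congr 1
      funext i
      exact hρ _ (hφ i)
    have hA : ∀ i, ρ (xs i) ∈ A := fun i => by
      rw [← hρ _ (hφ i)]
      exact h.getD_mem r hr _ (hφ i)
    obtain ⟨sc, ec, -, -, hl⟩ := h.local_conds c c.2 c c.2 c c.2 a₀ ha₀ r hr _ hle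
    have h1 := hl.atom _ _ rfl hcode
    have h2 := hl.rel_dom _ _ rfl hcode
    rw [hv] at h1 h2
    rw [h1]
    constructor
    · intro hR
      exact ⟨c, c.2, hl.le_refl, hR, fun i => ⟨hA i, h2 hR _ (by simp)⟩⟩
    -- The fact was recorded at an earlier state; this tuple comes from a relevant atom, so the
    -- table's own monotonicity carries it to `c`.
    · rintro ⟨c', hc', hlt, hR, -⟩
      obtain ⟨sc, ec, -, -, hl'⟩ := h.local_conds c' hc' c c.2 c c.2 a₀ ha₀ r hr _ hle
      have h3 := hl'.rel_mono _ _ rfl hcode hlt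
      rw [hv] at h3
      exact h3 hR
  | and φ ψ ih ih' =>
    have h1 := Nat.left_le_pair φ.code ψ.code
    have h2 := Nat.right_le_pair φ.code ψ.code
    have h3 : 6 * Nat.pair φ.code ψ.code + 2 ≤ t := hle
    obtain ⟨sc, ec, -, -, hl⟩ := h.local_conds c c.2 c c.2 c c.2 a₀ ha₀ r hr _ hle
    have hk := hl.isCode_and _ _ rfl hcode
    rw [hl.and _ _ rfl hcode, ih hφ.1 hk.1 (by omega) hr hρ, ih' hφ.2 hk.2 (by omega) hr hρ]
    rfl
  | or φ ψ ih ih' =>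
    have h1 := Nat.left_le_pair φ.code ψ.code
    have h2 := Nat.right_le_pair φ.code ψ.code
    have h3 : 6 * Nat.pair φ.code ψ.code + 3 ≤ t := hle
    obtain ⟨sc, ec, -, -, hl⟩ := h.local_conds c c.2 c c.2 c c.2 a₀ ha₀ r hr _ hle
    have hk := hl.isCode_or _ _ rfl hcode
    rw [hl.or _ _ rfl hcode, ih hφ.1 hk.1 (by omega) hr hρ, ih' hφ.2 hk.2 (by omega) hr hρ]
    rfl
  | imp φ ψ ih ih' =>
    have h1 := Nat.left_le_pair φ.code ψ.code
    have h2 := Nat.right_le_pair φ.code ψ.code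
    have h3 : 6 * Nat.pair φ.code ψ.code + 4 ≤ t := hle
    obtain ⟨sc, ec, hsc, -, hl⟩ := h.local_conds c c.2 c c.2 c c.2 a₀ ha₀ r hr _ hle
    have hk := hl.isCode_imp _ _ rfl hcode
    constructor
    · intro hF (d : S) hcd hd
      obtain ⟨sc, ec, -, -, hl⟩ := h.local_conds c c.2 d d.2 d d.2 a₀ ha₀ r hr _ hle
      exact (ih' hφ.2 hk.2 (by omega) hr hρ).1
        (hl.imp _ _ rfl hcode hF hcd ((ih hφ.1 hk.1 (by omega) hr hρ).2 hd))
    · intro hF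
      by_contra hn
      obtain ⟨w, hw, hcw, hu, hv⟩ := hl.not_imp _ _ rfl hcode hn
      exact hv ((ih' (c := ⟨w, hsc w hw⟩) hφ.2 hk.2 (by omega) hr hρ).2 (hF ⟨w, hsc w hw⟩ hcw
        ((ih (c := ⟨w, hsc w hw⟩) hφ.1 hk.1 (by omega) hr hρ).1 hu)))
  | all x φ ih =>
    have h2 := Nat.right_le_pair x φ.code
    have h3 : 6 * Nat.pair x φ.code + 5 ≤ t := hle
    obtain ⟨sc, ec, hsc, hec, hl⟩ := h.local_conds c c.2 c c.2 c c.2 a₀ ha₀ r hr _ hle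
    have hk := hl.isCode_all _ _ rfl hcode
    constructor
    · intro hF (d : S) hcd a ha
      obtain ⟨sc, ec, -, -, hl⟩ := h.local_conds c c.2 d d.2 d d.2 a ha.1 r hr _ hle
      exact (ih hφ.2 hk (by omega) (h.update r hr x a ha.1) (agree_update hρ)).1
        (hl.all _ _ rfl hcode hF hcd ha.2)
    · intro hF
      by_contra hn
      obtain ⟨w, hw, b, hb, hcw, hwb, hv⟩ := hl.not_all _ _ rfl hcode hn
      exact hv ((ih (c := ⟨w, hsc w hw⟩) hφ.2 hk (by omega) (h.update r hr x b (hec b hb))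
        (agree_update hρ)).2 (hF ⟨w, hsc w hw⟩ hcw b ⟨hec b hb, hwb⟩))
  | ex x φ ih =>
    have h2 := Nat.right_le_pair x φ.code
    have h3 : 6 * Nat.pair x φ.code + 6 ≤ t := hle
    obtain ⟨sc, ec, -, hec, hl⟩ := h.local_conds c c.2 c c.2 c c.2 a₀ ha₀ r hr _ hle
    have hk := hl.isCode_ex _ _ rfl hcode
    constructor
    · intro hF
      obtain ⟨b, hb, hcb, hv⟩ := hl.ex _ _ rfl hcode hF
      exact ⟨b, ⟨hec b hb, hcb⟩, (ih hφ.2 hk (by omega) (h.update r hr x b (hec b hb))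
        (agree_update hρ)).1 hv⟩
    · rintro ⟨a, ha, hF⟩
      by_contra hn
      obtain ⟨sc, ec, -, -, hl⟩ := h.local_conds c c.2 c c.2 c c.2 a ha.1 r hr _ hle
      exact hl.not_ex _ _ rfl hcode hn ha.2 ((ih hφ.2 hk (by omega) (h.update r hr x a ha.1)
        (agree_update hρ)).2 hF)
  | bot =>
    obtain ⟨sc, ec, -, -, hl⟩ := h.local_conds c c.2 c c.2 c c.2 a₀ ha₀ r hr _ hle
    exact iff_of_false hl.bot id

theorem toModel_models {τ : Formula ar} (h : IsTable V τ.code S A Q) :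
    (h.toModel ar).Models τ := by
  intro (c : S) ρ hρ
  obtain ⟨a₀, ha₀⟩ := h.elements_nonempty
  obtain ⟨r, hr, hag⟩ := h.exists_agree ρ fun x => (hρ x).1
  obtain ⟨sc, ec, -, -, hl⟩ := h.local_conds c c.2 c c.2 c c.2 a₀ ha₀ r hr _ le_rfl
  refine (h.forces_iff (Formula.varsBelow_of_code_lt (Nat.lt_succ_self _)) hl.isCode_root le_rfl
    hr hag).1 (hl.root fun x hx => ?_)
  rw [hag x hx]
  exact (hρ x).2

end IsTable

/-! ### From models to tables -/

section Codes

variable {P : Type} [Primcodable P] {ar : P → ℕ} {φ : Formula ar} {u v : ℕ}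

theorem Formula.exists_atom_of_code (h : φ.code = 6 * Nat.pair u v + 1) :
    ∃ p xs, φ = .atom p xs ∧ encode p = u ∧ encode (List.ofFn xs) = v := by
  cases φ <;> simp only [Formula.code] at h <;> try omega
  exact ⟨_, _, rfl, Nat.pair_eq_pair.1 (by omega)⟩

theorem Formula.exists_and_of_code (h : φ.code = 6 * Nat.pair u v + 2) :
    ∃ a b, φ = .and a b ∧ a.code = u ∧ b.code = v := by
  cases φ <;> simp only [Formula.code] at h <;> try omega
  exact ⟨_, _, rfl, Nat.pair_eq_pair.1 (by omega)⟩

theorem Formula.exists_or_of_code (h : φ.code = 6 * Nat.pair u v + 3) :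
    ∃ a b, φ = .or a b ∧ a.code = u ∧ b.code = v := by
  cases φ <;> simp only [Formula.code] at h <;> try omega
  exact ⟨_, _, rfl, Nat.pair_eq_pair.1 (by omega)⟩

theorem Formula.exists_imp_of_code (h : φ.code = 6 * Nat.pair u v + 4) :
    ∃ a b, φ = .imp a b ∧ a.code = u ∧ b.code = v := by
  cases φ <;> simp only [Formula.code] at h <;> try omega
  exact ⟨_, _, rfl, Nat.pair_eq_pair.1 (by omega)⟩

theorem Formula.exists_all_of_code (h : φ.code = 6 * Nat.pair u v + 5) :
    ∃ b, φ = .all u b ∧ b.code = v := by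
  cases φ <;> simp only [Formula.code] at h <;> try omega
  rename_i x b
  obtain ⟨rfl, rfl⟩ := Nat.pair_eq_pair.1 (show Nat.pair x b.code = Nat.pair u v by omega)
  exact ⟨_, rfl, rfl⟩

theorem Formula.exists_ex_of_code (h : φ.code = 6 * Nat.pair u v + 6) :
    ∃ b, φ = .ex u b ∧ b.code = v := by
  cases φ <;> simp only [Formula.code] at h <;> try omega
  rename_i x b
  obtain ⟨rfl, rfl⟩ := Nat.pair_eq_pair.1 (show Nat.pair x b.code = Nat.pair u v by omega)
  exact ⟨_, rfl, rfl⟩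

end Codes

namespace KripkeModel

variable {P : Type} [Primcodable P] {ar : P → ℕ} (M : KripkeModel ar) (t : ℕ) (π : ℕ → M.C)
  (σ : ℕ → M.D) (G : ℕ → ℕ → Prop)

/-- The truth of atoms when the number `n` names the state `π n` and the element `σ n`, and the
order of the named states is intersected with `G`. -/
def AtomHolds : Atom → Prop
  | (0, k, _, _) => ∃ φ : Formula ar, φ.code = k ∧ φ.VarsBelow (t + 1)
  | (1, c, d, _) => M.le (π c) (π d) ∧ G c d
  | (2, c, a, _) => σ a ∈ M.dom (π c)
  | (3, c, p, v) => ∃ (q : P) (w : Fin (ar q) → M.D), encode q = p ∧ List.ofFn w = v.map σ ∧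
      M.rel (π c) q w
  | (4, c, k, r) => ∃ φ : Formula ar, φ.code = k ∧ M.Forces (π c) (fun x => σ (r.getD x 0)) φ
  | _ => False

open Classical in
/-- The table of the named part of a Kripke model. -/
noncomputable def table (x : Atom) : Bool := decide (M.AtomHolds t π σ G x)

variable {M t π σ G}

theorem table_iff {x : Atom} : M.table t π σ G x ↔ M.AtomHolds t π σ G x := by
  simp [table]

theorem table_isCode {k : ℕ} : M.table t π σ G (.isCode k) ↔
    ∃ φ : Formula ar, φ.code = k ∧ φ.VarsBelow (t + 1) :=
  table_iff

theorem table_isCode_of {φ : Formula ar} (h : φ.VarsBelow (t + 1)) :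
    M.table t π σ G (.isCode φ.code) :=
  table_isCode.2 ⟨φ, rfl, h⟩

theorem table_le {c d : ℕ} : M.table t π σ G (.le c d) ↔ M.le (π c) (π d) ∧ G c d :=
  table_iff

theorem table_dom {c a : ℕ} : M.table t π σ G (.dom c a) ↔ σ a ∈ M.dom (π c) :=
  table_iff

theorem table_rel {c p : ℕ} {v : List ℕ} : M.table t π σ G (.rel c p v) ↔
    ∃ (q : P) (w : Fin (ar q) → M.D), encode q = p ∧ List.ofFn w = v.map σ ∧
      M.rel (π c) q w :=
  table_iff

theorem table_forces {c : ℕ} {r : List ℕ} {φ : Formula ar} :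
    M.table t π σ G (.forces c r φ.code) ↔ M.Forces (π c) (fun x => σ (r.getD x 0)) φ := by
  refine table_iff.trans ⟨?_, ?_⟩
  · rintro ⟨ψ, hψ, h⟩
    rwa [← Formula.code_injective hψ]
  · exact fun h => ⟨φ, rfl, h⟩

theorem table_forces_update {c x a : ℕ} {r : List ℕ} {φ : Formula ar}
    (hφ : φ.VarsBelow (t + 1)) :
    M.table t π σ G (.forces c (updateList (t + 1) r x a) φ.code) ↔
      M.Forces (π c) (Function.update (fun x => σ (r.getD x 0)) x (σ a)) φ := by
  rw [table_forces]
  refine forces_congr M hφ fun y hy => ?_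
  rw [getD_updateList hy, Function.update_apply]
  split <;> rfl

theorem table_rel_values {c : ℕ} {r : List ℕ} {p : P} {xs : Fin (ar p) → ℕ} :
    M.table t π σ G (.rel c (encode p) (values r (encode (List.ofFn xs)))) ↔
      M.rel (π c) p fun i => σ (r.getD (xs i) 0) := by
  have hv : (values r (encode (List.ofFn xs))).map σ =
      List.ofFn fun i => σ (r.getD (xs i) 0) := by
    rw [values, Denumerable.ofNat_encode, List.map_ofFn, List.map_ofFn]
    rfl
  rw [table_rel, hv]
  constructor
  · rintro ⟨q, w, hq, hw, h⟩
    obtain rfl := encode_injective hq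
    rwa [← List.ofFn_injective hw]
  · exact fun h => ⟨p, _, rfl, rfl, h⟩

/-- Forcing is evaluated in `M` with its full order, so conditions that quantify over all later
states survive the intersection with `G`. Only those demanding a named element or state become
hypotheses. -/
theorem locally_table {τ : Formula ar} (hM : M.Models τ) {sc ec : List ℕ} {c d e a : ℕ}
    {r : List ℕ} {k : ℕ} (hrefl : G c c) (htrans : G c d → G d e → G c e)
    (hanti : M.le (π c) (π d) → G c d → M.le (π d) (π c) → G d c → c = d)
    (hdom : ∃ b ∈ ec, σ b ∈ M.dom (π c))
    (himp : ∀ φ ψ : Formula ar, (Formula.imp φ ψ).code = k →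
      ¬M.Forces (π c) (fun x => σ (r.getD x 0)) (.imp φ ψ) → ∃ w ∈ sc, M.le (π c) (π w) ∧ G c w ∧
        M.Forces (π w) (fun x => σ (r.getD x 0)) φ ∧ ¬M.Forces (π w) (fun x => σ (r.getD x 0)) ψ)
    (hall : ∀ x (φ : Formula ar), (Formula.all x φ).code = k →
      ¬M.Forces (π c) (fun x => σ (r.getD x 0)) (.all x φ) →
        ∃ w ∈ sc, ∃ b ∈ ec, M.le (π c) (π w) ∧ G c w ∧ σ b ∈ M.dom (π w) ∧
          ¬M.Forces (π w) (Function.update (fun x => σ (r.getD x 0)) x (σ b)) φ)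
    (hex : ∀ x (φ : Formula ar), (Formula.ex x φ).code = k →
      M.Forces (π c) (fun x => σ (r.getD x 0)) (.ex x φ) → ∃ b ∈ ec, σ b ∈ M.dom (π c) ∧
        M.Forces (π c) (Function.update (fun x => σ (r.getD x 0)) x (σ b)) φ) :
    Locally (M.table τ.code π σ G) τ.code sc ec c d e a r k where
  isCode_root := table_isCode_of (Formula.varsBelow_of_code_lt (Nat.lt_succ_self _))
  le_refl := table_le.2 ⟨M.le_refl _, hrefl⟩
  le_trans h h' := by
    rw [table_le] at *
    exact ⟨M.le_trans _ _ _ h.1 h'.1, htrans h.2 h'.2⟩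
  le_antisymm h h' := by
    rw [table_le] at *
    exact hanti h.1 h.2 h'.1 h'.2
  dom_nonempty := by simpa only [table_dom] using hdom
  dom_mono h h' := by
    rw [table_le] at h
    rw [table_dom] at *
    exact M.dom_mono _ _ h.1 h'
  root h := by
    simp only [table_dom] at h
    obtain ⟨a₀, ha₀⟩ := M.dom_nonempty (π c)
    -- Beyond the variables of `τ`, the names in `r` may denote elements outside the universe of `π
    -- c`. They are replaced by `a₀`, which does not affect `τ`.
    have hm := hM (π c) (fun x => if x < τ.code + 1 then σ (r.getD x 0) else a₀) fun x => by
      split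
      · exact h x ‹_›
      · exact ha₀
    rw [table_forces, forces_congr M (Formula.varsBelow_of_code_lt (Nat.lt_succ_self _))]
    · exact hm
    · intro x hx
      simp only [hx, if_true]
  rel_mono u v hk hc hcd := by
    obtain ⟨φ, rfl, -⟩ := table_isCode.1 hc
    obtain ⟨p, xs, rfl, rfl, rfl⟩ := Formula.exists_atom_of_code hk
    rw [table_rel_values, table_rel_values]
    exact M.rel_mono _ _ (table_le.1 hcd).1 _ _
  atom u v hk hc := by
    obtain ⟨φ, rfl, -⟩ := table_isCode.1 hc
    obtain ⟨p, xs, rfl, rfl, rfl⟩ := Formula.exists_atom_of_code hk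
    rw [table_rel_values, table_forces, Forces]
  rel_dom u v hk hc h b hb := by
    obtain ⟨φ, rfl, -⟩ := table_isCode.1 hc
    obtain ⟨p, xs, rfl, rfl, rfl⟩ := Formula.exists_atom_of_code hk
    rw [table_rel_values] at h
    rw [values, Denumerable.ofNat_encode, List.map_ofFn, List.mem_ofFn] at hb
    obtain ⟨i, rfl⟩ := hb
    exact table_dom.2 (M.rel_dom _ _ _ h i)
  isCode_and u v hk hc := by
    obtain ⟨φ, rfl, hφ⟩ := table_isCode.1 hc
    obtain ⟨φ, ψ, rfl, rfl, rfl⟩ := Formula.exists_and_of_code hk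
    exact ⟨table_isCode_of hφ.1, table_isCode_of hφ.2⟩
  and u v hk hc := by
    obtain ⟨φ, rfl, -⟩ := table_isCode.1 hc
    obtain ⟨φ, ψ, rfl, rfl, rfl⟩ := Formula.exists_and_of_code hk
    rw [table_forces, table_forces, table_forces, Forces]
  isCode_or u v hk hc := by
    obtain ⟨φ, rfl, hφ⟩ := table_isCode.1 hc
    obtain ⟨φ, ψ, rfl, rfl, rfl⟩ := Formula.exists_or_of_code hk
    exact ⟨table_isCode_of hφ.1, table_isCode_of hφ.2⟩
  or u v hk hc := by
    obtain ⟨φ, rfl, -⟩ := table_isCode.1 hc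
    obtain ⟨φ, ψ, rfl, rfl, rfl⟩ := Formula.exists_or_of_code hk
    rw [table_forces, table_forces, table_forces, Forces]
  isCode_imp u v hk hc := by
    obtain ⟨φ, rfl, hφ⟩ := table_isCode.1 hc
    obtain ⟨φ, ψ, rfl, rfl, rfl⟩ := Formula.exists_imp_of_code hk
    exact ⟨table_isCode_of hφ.1, table_isCode_of hφ.2⟩
  imp u v hk hc := by
    obtain ⟨φ, rfl, -⟩ := table_isCode.1 hc
    obtain ⟨φ, ψ, rfl, rfl, rfl⟩ := Formula.exists_imp_of_code hk
    rw [table_forces, table_forces, table_forces, table_le]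
    exact fun h hcd => h _ hcd.1
  not_imp u v hk hc := by
    obtain ⟨φ, rfl, -⟩ := table_isCode.1 hc
    obtain ⟨φ, ψ, rfl, rfl, rfl⟩ := Formula.exists_imp_of_code hk
    simp only [table_forces, table_le, and_assoc]
    exact himp φ ψ rfl
  isCode_all u v hk hc := by
    obtain ⟨φ, rfl, hφ⟩ := table_isCode.1 hc
    obtain ⟨φ, rfl, rfl⟩ := Formula.exists_all_of_code hk
    exact table_isCode_of hφ.2
  all u v hk hc := by
    obtain ⟨φ, rfl, hφ⟩ := table_isCode.1 hc
    obtain ⟨φ, rfl, rfl⟩ := Formula.exists_all_of_code hk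
    rw [table_forces, table_forces_update hφ.2, table_le, table_dom]
    exact fun h hcd ha => h _ hcd.1 _ ha
  not_all u v hk hc := by
    obtain ⟨φ, rfl, hφ⟩ := table_isCode.1 hc
    obtain ⟨φ, rfl, rfl⟩ := Formula.exists_all_of_code hk
    simp only [table_forces, table_forces_update hφ.2, table_le, table_dom, and_assoc]
    exact hall u φ rfl
  isCode_ex u v hk hc := by
    obtain ⟨φ, rfl, hφ⟩ := table_isCode.1 hc
    obtain ⟨φ, rfl, rfl⟩ := Formula.exists_ex_of_code hk
    exact table_isCode_of hφ.2
  not_ex u v hk hc := by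
    obtain ⟨φ, rfl, hφ⟩ := table_isCode.1 hc
    obtain ⟨φ, rfl, rfl⟩ := Formula.exists_ex_of_code hk
    rw [table_forces, table_forces_update hφ.2, table_dom]
    exact fun h ha h' => h ⟨_, ha, h'⟩
  ex u v hk hc := by
    obtain ⟨φ, rfl, hφ⟩ := table_isCode.1 hc
    obtain ⟨φ, rfl, rfl⟩ := Formula.exists_ex_of_code hk
    simp only [table_forces, table_forces_update hφ.2, table_dom]
    exact hex u φ rfl
  bot := fun h => (table_forces (φ := .bot)).1 h

end KripkeModel

/-! ### Unsatisfiability is recursively enumerable -/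

/-- The name of the witness for the formula with code `k` at state `c` under the valuation `r`. -/
def witness (c : ℕ) (r : List ℕ) (k : ℕ) : ℕ := Nat.pair c (Nat.pair (encode r) k) + 1

/-- A condition on a table in which all witnesses have their canonical names: the one with the
index `x.1` among those at the remaining components of `x`. -/
def henkinCond (t : ℕ) (x : ℕ × ℕ × ℕ × ℕ × ℕ × List ℕ × ℕ) : List (List (Atom × Bool)) :=
  (conds t [witness x.2.1 x.2.2.2.2.2.1 x.2.2.2.2.2.2]
    [0, witness x.2.1 x.2.2.2.2.2.1 x.2.2.2.2.2.2] x.2.1 x.2.2.1 x.2.2.2.1 x.2.2.2.2.1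
    x.2.2.2.2.2.1 x.2.2.2.2.2.2).getD x.1 [[]]

/-- An enumeration of all instances of `henkinCond`. -/
def henkinConds (t i : ℕ) : List (List (Atom × Bool)) :=
  henkinCond t ((decode i).getD default)

@[fun_prop]
theorem primrec_witness_comp {α : Type*} [Primcodable α] {c k : α → ℕ} {r : α → List ℕ}
    (hc : Primrec c) (hr : Primrec r) (hk : Primrec k) :
    Primrec fun x => witness (c x) (r x) (k x) := by
  unfold witness
  fun_prop

theorem primrec_henkinCond : Primrec₂ henkinCond := by
  unfold henkinCond
  refine primrec_getD_comp (primrec_conds_comp ?_ ?_ ?_ ?_ ?_ ?_ ?_ ?_ ?_) ?_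
  all_goals fun_prop

theorem primrec_henkinConds : Primrec fun x : ℕ × ℕ => henkinConds x.1 x.2 :=
  primrec_henkinCond.comp Primrec.fst (primrec_decode_getD_comp Primrec.snd)

theorem forall_henkinConds_sat_iff {V : Atom → Bool} {t : ℕ} :
    (∀ i, Sat V (henkinConds t i)) ↔ ∀ c d e a r k,
      Locally V t [witness c r k] [0, witness c r k] c d e a r k := by
  simp only [← forall_conds_sat_iff]
  constructor
  · intro h c d e a r k δ hδ
    obtain ⟨j, hj, rfl⟩ := List.getElem_of_mem hδ
    have hi := h (encode ((j, c, d, e, a, r, k) : ℕ × ℕ × ℕ × ℕ × ℕ × List ℕ × ℕ))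
    simp only [henkinConds, encodek, Option.getD_some, henkinCond] at hi
    rwa [List.getD_eq_getElem _ _ hj] at hi
  · intro h i
    rw [henkinConds, henkinCond, List.getD_eq_getElem?_getD]
    generalize hx : (decode (α := ℕ × ℕ × ℕ × ℕ × ℕ × List ℕ × ℕ) i).getD default = x
    obtain ⟨j, c, d, e, a, r, k⟩ := x
    dsimp only
    cases hg : (conds t [witness c r k] [0, witness c r k] c d e a r k)[j]? with
    | none => simp [Sat]
    | some δ => exact h _ _ _ _ _ _ δ (List.mem_of_getElem? hg)

/-- A formula has only one main connective, so a single pair of a state and an element serves all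
three cases; where nothing is demanded, a dummy pair does. -/
theorem KripkeModel.exists_witness_formula {P : Type} {ar : P → ℕ} (M : KripkeModel ar)
    (c : M.C) (ρ : ℕ → M.D) (χ : Formula ar) : ∃ p : M.C × M.D, M.le c p.1 ∧
      (∀ φ ψ, χ = .imp φ ψ → ¬M.Forces c ρ χ → M.Forces p.1 ρ φ ∧ ¬M.Forces p.1 ρ ψ) ∧
      (∀ x φ, χ = .all x φ → ¬M.Forces c ρ χ →
        p.2 ∈ M.dom p.1 ∧ ¬M.Forces p.1 (Function.update ρ x p.2) φ) ∧
      (∀ x φ, χ = .ex x φ → M.Forces c ρ χ →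
        p.2 ∈ M.dom c ∧ M.Forces c (Function.update ρ x p.2) φ) := by
  by_cases hF : M.Forces c ρ χ
  · cases χ with
    | ex x φ =>
      obtain ⟨a, ha, h⟩ := hF
      refine ⟨(c, a), M.le_refl c, by simp, by simp, ?_⟩
      rintro _ _ ⟨⟩ -
      exact ⟨ha, h⟩
    | _ => exact ⟨(c, ρ 0), M.le_refl c, by simp_all, by simp_all, by simp⟩
  · cases χ with
    | imp φ ψ =>
      have hn := hF
      simp only [KripkeModel.Forces, not_forall] at hn
      obtain ⟨d, hcd, h, h'⟩ := hn
      refine ⟨(d, ρ 0), hcd, ?_, by simp, by simp⟩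
      rintro _ _ ⟨⟩ -
      exact ⟨h, h'⟩
    | all x φ =>
      have hn := hF
      simp only [KripkeModel.Forces, not_forall] at hn
      obtain ⟨d, hcd, a, ha, h⟩ := hn
      refine ⟨(d, a), hcd, by simp, ?_, by simp⟩
      rintro _ _ ⟨⟩ -
      exact ⟨ha, h⟩
    | _ => exact ⟨(c, ρ 0), M.le_refl c, by simp, by simp, by simp_all⟩

section Henkin

variable {P : Type} [Primcodable P] {ar : P → ℕ}

theorem satisfiable_of_henkinConds {τ : Formula ar} {V : Atom → Bool}
    (h : ∀ i, Sat V (henkinConds τ.code i)) : Satisfiable τ := by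
  rw [forall_henkinConds_sat_iff] at h
  have hT : IsTable V τ.code Set.univ Set.univ Set.univ :=
    ⟨Set.univ_nonempty, Set.univ_nonempty, Set.univ_nonempty, fun _ _ _ _ _ => trivial,
      fun _ _ _ _ => trivial, fun c _ d _ e _ a _ r _ k _ =>
        ⟨_, _, fun _ _ => trivial, fun _ _ => trivial, h c d e a r k⟩⟩
  exact ⟨_, hT.toModel_models⟩

/-- Indexing by numbers instead of formulas lets the choice of witnesses be iterated along names;
injectivity of the coding makes this harmless. -/
theorem KripkeModel.exists_witness (M : KripkeModel ar) (c : M.C) (ρ : ℕ → M.D) (k : ℕ) :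
    ∃ p : M.C × M.D, M.le c p.1 ∧ ∀ χ : Formula ar, χ.code = k →
      (∀ φ ψ, χ = .imp φ ψ → ¬M.Forces c ρ χ → M.Forces p.1 ρ φ ∧ ¬M.Forces p.1 ρ ψ) ∧
      (∀ x φ, χ = .all x φ → ¬M.Forces c ρ χ →
        p.2 ∈ M.dom p.1 ∧ ¬M.Forces p.1 (Function.update ρ x p.2) φ) ∧
      (∀ x φ, χ = .ex x φ → M.Forces c ρ χ →
        p.2 ∈ M.dom c ∧ M.Forces c (Function.update ρ x p.2) φ) := by
  by_cases h : ∃ χ : Formula ar, χ.code = k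
  · obtain ⟨χ, rfl⟩ := h
    obtain ⟨p, hp, h⟩ := M.exists_witness_formula c ρ χ
    exact ⟨p, hp, fun χ' hχ' => Formula.code_injective hχ' ▸ h⟩
  · exact ⟨(c, ρ 0), M.le_refl c, fun χ hχ => absurd ⟨χ, hχ⟩ h⟩

/-- The state and the element named by a number, if `step` chooses the witnesses. -/
def interpret {C D : Type} (p₀ : C × D) (step : C → (ℕ → D) → ℕ → C × D) : ℕ → C × D
  | 0 => p₀
  | n + 1 => step (interpret p₀ step n.unpair.1).1
      (fun x => (interpret p₀ step
        ((Denumerable.ofNat (List ℕ) n.unpair.2.unpair.1).getD x 0)).2) n.unpair.2.unpair.2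
-- The name of a witness exceeds the name of its state and every entry of its valuation.
decreasing_by
  · exact Nat.lt_succ_of_le (Nat.unpair_left_le n)
  · refine Nat.lt_succ_of_le ((getD_le_encode _ x).trans ?_)
    rw [Denumerable.encode_ofNat]
    exact (Nat.unpair_left_le _).trans (Nat.unpair_right_le n)

theorem interpret_witness {C D : Type} (p₀ : C × D) (step : C → (ℕ → D) → ℕ → C × D) (c : ℕ)
    (r : List ℕ) (k : ℕ) : interpret p₀ step (witness c r k) =
      step (interpret p₀ step c).1 (fun x => (interpret p₀ step (r.getD x 0)).2) k := by
  rw [witness, interpret]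
  simp

theorem exists_henkinConds_sat {τ : Formula ar} (h : Satisfiable τ) :
    ∃ V : Atom → Bool, ∀ i, Sat V (henkinConds τ.code i) := by
  obtain ⟨M, hM⟩ := h
  obtain ⟨c₀⟩ := M.C_nonempty
  obtain ⟨a₀, ha₀⟩ := M.dom_nonempty c₀
  choose step hstep using M.exists_witness
  set I := interpret (c₀, a₀) step with hI
  -- All named states lie above `c₀`, so the element named 0 is in every universe. That is why 0 is
  -- among the candidate elements in `henkinCond`.
  have hroot : ∀ n, M.le c₀ (I n).1 := by
    intro n
    induction n using Nat.strong_induction_on with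
    | _ n ih =>
      cases n with
      | zero => rw [hI, interpret]; exact M.le_refl _
      | succ n =>
        rw [hI, interpret]
        exact M.le_trans _ _ _ (ih _ (Nat.lt_succ_of_le (Nat.unpair_left_le n))) (hstep _ _ _).1
  have hI0 : (I 0).2 = a₀ := by rw [hI, interpret]
  have hlt : ∀ c r k, c ≤ witness c r k := fun c r k =>
    (Nat.left_le_pair _ _).trans (Nat.le_succ _)
  -- One state may have many names, which would break antisymmetry. Intersecting with the order of
  -- the names restores it, and loses no witness since a witness's name is at least that of its
  -- state.
  refine ⟨M.table τ.code (fun n => (I n).1) (fun n => (I n).2) (· ≤ ·),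
    forall_henkinConds_sat_iff.2 fun c d e a r k => ?_⟩
  have hw := hstep (I c).1 (fun x => (I (r.getD x 0)).2) k
  rw [hI, ← interpret_witness (c₀, a₀) step c r k, ← hI] at hw
  refine KripkeModel.locally_table hM le_rfl le_trans (fun _ h _ h' => le_antisymm h h')
    ⟨0, by simp, ?_⟩ ?_ ?_ ?_
  · rw [hI0]
    exact M.dom_mono _ _ (hroot c) ha₀
  · intro φ ψ hk hn
    exact ⟨_, by simp, hw.1, hlt c r k, (hw.2 _ hk).1 φ ψ rfl hn⟩
  · intro x φ hk hn
    exact ⟨_, by simp, witness c r k, by simp, hw.1, hlt c r k, (hw.2 _ hk).2.1 x φ rfl hn⟩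
  · intro x φ hk hF
    exact ⟨witness c r k, by simp, (hw.2 _ hk).2.2 x φ rfl hF⟩

theorem exists_refuted_iff_not_satisfiable (τ : Formula ar) :
    (∃ n, ∀ w ∈ allLists n 2, Refuted henkinConds τ.code n w) ↔ ¬Satisfiable τ := by
  rw [exists_refuted_iff, not_iff_not]
  exact ⟨fun ⟨_, h⟩ => satisfiable_of_henkinConds h, exists_henkinConds_sat⟩

end Henkin

/-! ### Having a finite model is recursively enumerable -/

/-- The conditions on a table with the states `0, …, k` and the elements `0, …, m`. -/
def finiteConds (t k m : ℕ) : List (List (List (Atom × Bool))) :=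
  -- Every listed element must occur in some universe, so that the union has exactly `m + 1`
  -- elements and the size is exact.
  (List.range (m + 1)).map (fun a => (List.range (k + 1)).map fun c => [(Atom.dom c a, true)]) ++
  (List.range (k + 1)).flatMap fun c => (List.range (k + 1)).flatMap fun d =>
  (List.range (k + 1)).flatMap fun e => (List.range (m + 1)).flatMap fun a =>
  (allLists (t + 1) (m + 1)).flatMap fun r => (List.range (t + 1)).flatMap fun j =>
    conds t (List.range (k + 1)) (List.range (m + 1)) c d e a r j

@[fun_prop]
theorem primrec_finiteConds_comp {α : Type*} [Primcodable α] {t k m : α → ℕ} (ht : Primrec t)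
    (hk : Primrec k) (hm : Primrec m) : Primrec fun x => finiteConds (t x) (k x) (m x) := by
  unfold finiteConds
  fun_prop

/-- The list `T` of true atoms describes a model of the formula with code `t` that has the states
`0, …, k` and the elements `0, …, m`. -/
def IsFiniteTable (t k m : ℕ) (T : List Atom) : Prop :=
  ∀ δ ∈ finiteConds t k m, Sat (fun x => if x ∈ T then true else false) δ

theorem primrecPred_isFiniteTable {α : Type*} [Primcodable α] {t k m : α → ℕ}
    {T : α → List Atom} (ht : Primrec t) (hk : Primrec k) (hm : Primrec m) (hT : Primrec T) :
    PrimrecPred fun x => IsFiniteTable (t x) (k x) (m x) (T x) := by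
  refine primrecPred_ball (by fun_prop) (primrecPred_bex (by fun_prop) (primrecPred_ball
    (by fun_prop) (Primrec.eq.comp (Primrec.ite (primrecPred_mem ?_ ?_) ?_ ?_) ?_)))
  all_goals fun_prop

theorem forall_finiteConds_sat_iff {V : Atom → Bool} {t k m : ℕ} :
    (∀ δ ∈ finiteConds t k m, Sat V δ) ↔
      (∀ a < m + 1, ∃ c < k + 1, V (.dom c a)) ∧
      ∀ c < k + 1, ∀ d < k + 1, ∀ e < k + 1, ∀ a < m + 1, ∀ r ∈ allLists (t + 1) (m + 1),
        ∀ j < t + 1, Locally V t (List.range (k + 1)) (List.range (m + 1)) c d e a r j := by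
  simp only [← forall_conds_sat_iff, finiteConds, List.mem_append, or_imp, forall_and,
    List.forall_mem_map, sat_map, List.mem_flatMap, List.mem_range, List.forall_mem_cons,
    List.not_mem_nil, false_imp_iff, implies_true, and_true]
  refine and_congr Iff.rfl ⟨fun h c hc d hd e he a ha r hr j hj δ hδ =>
    h δ ⟨c, hc, d, hd, e, he, a, ha, r, hr, j, hj, hδ⟩, ?_⟩
  rintro h δ ⟨c, hc, d, hd, e, he, a, ha, r, hr, j, hj, hδ⟩
  exact h c hc d hd e he a ha r hr j hj δ hδ

/-- Finitely many conditions are decided by finitely many true atoms. -/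
theorem exists_list_sat {V : Atom → Bool} {Δ : List (List (List (Atom × Bool)))}
    (h : ∀ δ ∈ Δ, Sat V δ) :
    ∃ T : List Atom, ∀ δ ∈ Δ, Sat (fun x => if x ∈ T then true else false) δ := by
  refine ⟨(Δ.flatten.flatten.map Prod.fst).filter fun x => V x, fun δ hδ => ?_⟩
  obtain ⟨γ, hγ, hV⟩ := h δ hδ
  refine ⟨γ, hγ, fun l hl => ?_⟩
  have hmem : l.1 ∈ Δ.flatten.flatten.map Prod.fst :=
    List.mem_map_of_mem (List.mem_flatten_of_mem (List.mem_flatten_of_mem hδ hγ) hl)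
  rw [← hV l hl]
  simp only [List.mem_filter, hmem, true_and]
  cases V l.1 <;> simp

theorem exists_enumeration {α : Type} {U : Set α} (hU : U.Finite) (hne : U.Nonempty) :
    ∃ (n : ℕ) (f : ℕ → α), (∀ i < n + 1, f i ∈ U) ∧ (∀ x ∈ U, ∃ i < n + 1, f i = x) ∧
      ∀ i < n + 1, ∀ j < n + 1, f i = f j → i = j := by
  have := hU.fintype
  have := hne.to_subtype
  obtain ⟨n, hn⟩ := Nat.exists_eq_succ_of_ne_zero (Fintype.card_ne_zero (α := U))
  let g : U ≃ Fin (n + 1) := Fintype.equivFinOfCardEq hn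
  have hval : ∀ i < n + 1, ((Fin.ofNat (n + 1) i : Fin (n + 1)) : ℕ) = i := fun i hi => by
    simp [Nat.mod_eq_of_lt hi]
  refine ⟨n, fun i => g.symm (Fin.ofNat (n + 1) i), fun i _ => (g.symm _).2, fun x hx =>
    ⟨g ⟨x, hx⟩, (g ⟨x, hx⟩).2, ?_⟩, fun i hi j hj hij => ?_⟩
  · simp
  · have := congrArg Fin.val (g.symm.injective (Subtype.ext hij))
    rwa [hval i hi, hval j hj] at this

section Finite

variable {P : Type} [Primcodable P] {ar : P → ℕ}

theorem exists_isFiniteTable {τ : Formula ar} {M : KripkeModel ar} (hfin : M.IsFinite)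
    (hM : M.Models τ) : ∃ k m T, IsFiniteTable τ.code k m T := by
  have := hfin.1
  have := M.C_nonempty
  obtain ⟨k, π, -, hπ, hπi⟩ := exists_enumeration (Set.finite_univ (α := M.C)) Set.univ_nonempty
  obtain ⟨c₀⟩ := M.C_nonempty
  obtain ⟨a₀, ha₀⟩ := M.dom_nonempty c₀
  obtain ⟨m, σ, hσm, hσ, -⟩ := exists_enumeration (Set.finite_iUnion hfin.2)
    ⟨a₀, Set.mem_iUnion.2 ⟨c₀, ha₀⟩⟩
  have hσ' : ∀ c, ∀ x ∈ M.dom c, ∃ i < m + 1, σ i = x := fun c x hx =>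
    hσ x (Set.mem_iUnion.2 ⟨c, hx⟩)
  suffices h : ∀ δ ∈ finiteConds τ.code k m,
      Sat (M.table τ.code π σ fun _ _ => True) δ from ⟨k, m, exists_list_sat h⟩
  refine forall_finiteConds_sat_iff.2 ⟨fun a ha => ?_, fun c hc d hd e he a ha r hr j hj => ?_⟩
  · obtain ⟨c, hc⟩ := Set.mem_iUnion.1 (hσm a ha)
    obtain ⟨i, hi, rfl⟩ := hπ c trivial
    exact ⟨i, hi, KripkeModel.table_dom.2 hc⟩
  refine KripkeModel.locally_table hM trivial (fun _ _ => trivial)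
    -- The enumeration of states is injective, so the order needs no thinning here.
    (fun h _ h' _ => hπi c hc d hd (M.le_antisymm _ _ h h')) ?_ ?_ ?_ ?_
  · obtain ⟨x, hx⟩ := M.dom_nonempty (π c)
    obtain ⟨i, hi, rfl⟩ := hσ' _ x hx
    exact ⟨i, List.mem_range.2 hi, hx⟩
  · intro φ ψ _ hn
    simp only [KripkeModel.Forces, not_forall] at hn
    obtain ⟨d, hcd, h, h'⟩ := hn
    obtain ⟨i, hi, rfl⟩ := hπ d trivial
    exact ⟨i, List.mem_range.2 hi, hcd, trivial, h, h'⟩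
  · intro x φ _ hn
    simp only [KripkeModel.Forces, not_forall] at hn
    obtain ⟨d, hcd, a, ha, h⟩ := hn
    obtain ⟨i, hi, rfl⟩ := hπ d trivial
    obtain ⟨b, hb, rfl⟩ := hσ' _ a ha
    exact ⟨i, List.mem_range.2 hi, b, List.mem_range.2 hb, hcd, trivial, ha, h⟩
  · rintro x φ _ ⟨a, ha, h⟩
    obtain ⟨b, hb, rfl⟩ := hσ' _ a ha
    exact ⟨b, List.mem_range.2 hb, ha, h⟩

theorem IsFiniteTable.exists_model {τ : Formula ar} {k m : ℕ} {T : List Atom}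
    (h : IsFiniteTable τ.code k m T) :
    ∃ M : KripkeModel ar, M.IsFinite ∧ M.size = (k + 1) + (m + 1) ∧ M.Models τ := by
  obtain ⟨hsurj, hloc⟩ := forall_finiteConds_sat_iff.1 h
  have hT : IsTable (fun x => if x ∈ T then true else false) τ.code (Set.Iio (k + 1))
      (Set.Iio (m + 1)) {r | r ∈ allLists (τ.code + 1) (m + 1)} := by
    refine ⟨⟨0, Nat.succ_pos k⟩, ⟨0, Nat.succ_pos m⟩, ⟨List.replicate (τ.code + 1) 0, ?_⟩, ?_, ?_,
      fun c hc d hd e he a ha r hr j hj => ⟨_, _, fun w hw => List.mem_range.1 hw,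
        fun b hb => List.mem_range.1 hb, hloc c hc d hd e he a ha r hr j (Nat.lt_succ_of_le hj)⟩⟩
    · refine mem_allLists.2 ⟨List.length_replicate, fun y hy => ?_⟩
      rw [List.eq_of_mem_replicate hy]
      exact Nat.succ_pos m
    · intro r hr x a ha
      obtain ⟨hlen, hlt⟩ := mem_allLists.1 hr
      refine mem_allLists.2 ⟨by simp [updateList], fun y hy => ?_⟩
      obtain ⟨z, hz, rfl⟩ := List.mem_map.1 hy
      split
      · exact ha
      · rw [List.getD_eq_getElem _ _ (by rw [hlen]; exact List.mem_range.1 hz)]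
        exact hlt _ (List.getElem_mem _)
    · intro r hr x hx
      obtain ⟨hlen, hlt⟩ := mem_allLists.1 hr
      rw [List.getD_eq_getElem _ _ (by rw [hlen]; exact hx)]
      exact hlt _ (List.getElem_mem _)
  refine ⟨hT.toModel ar, ⟨(Set.finite_Iio (k + 1)).to_subtype, fun c =>
    (Set.finite_Iio (m + 1)).subset fun a ha => ha.1⟩, ?_, hT.toModel_models⟩
  have hU : (⋃ c, (hT.toModel ar).dom c) = Set.Iio (m + 1) := by
    refine Set.Subset.antisymm (Set.iUnion_subset fun c a ha => ha.1) fun a ha => ?_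
    obtain ⟨c, hc, hca⟩ := hsurj a ha
    exact Set.mem_iUnion.2 ⟨⟨c, hc⟩, ha, hca⟩
  have hC : Nat.card (hT.toModel ar).C = k + 1 := by
    change Nat.card (Set.Iio (k + 1)) = k + 1
    simp
  have hD : (⋃ c, (hT.toModel ar).dom c).ncard = m + 1 := by
    refine (congrArg Set.ncard hU).trans ?_
    change (Set.Iio (m + 1) : Set ℕ).ncard = m + 1
    rw [← Nat.card_coe_set_eq]
    exact Nat.card_eq_of_equiv_fin (Fintype.equivFinOfCardEq (by simp))
  rw [KripkeModel.size, hC, hD]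

end Finite

/-! ### The search for a refutation or a finite model

Model checking of a single formula is always decidable, so the effectiveness of the class is not
needed for the search. -/

open Classical in
/-- The result of testing whether `w` is a bound for a refutation of the formula with code `t`, or
the code of a finite table for it; in the latter case, the size of the model described. -/
noncomputable def searchResult (t w : ℕ) : Option ℕ :=
  let x := (decode (α := ℕ × ℕ × List Atom) w).getD default
  -- The value 0 is arbitrary: nothing is required of the bound for an unsatisfiable formula.
  if ∀ b ∈ allLists w 2, Refuted henkinConds t w b then some 0
  else if IsFiniteTable t x.1 x.2.1 x.2.2 then some ((x.1 + 1) + (x.2.1 + 1)) else none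

theorem primrec_searchResult : Primrec₂ searchResult := by
  change Primrec fun p : ℕ × ℕ => searchResult p.1 p.2
  unfold searchResult
  classical
  refine Primrec.ite (primrecPred_refuted primrec_henkinConds) (Primrec.const _)
    (Primrec.ite (primrecPred_isFiniteTable ?_ ?_ ?_ ?_) (Primrec.option_some.comp ?_)
      (Primrec.const _))
  all_goals fun_prop

/-- The finite model property makes the search halt on `X`. For a satisfiable formula no refutation
can be found, so the value returned is the size of a model described by the table found, which need
not be the model that ensured halting. -/
theorem FiniteModelProperty.smallModelProperty {P : Type} [Primcodable P] {ar : P → ℕ}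
    {X : Set (Formula ar)} (h : FiniteModelProperty X) : SmallModelProperty X := by
  classical
  let f : ℕ →. ℕ := fun t => Nat.rfindOpt (searchResult t)
  have hf : Nat.Partrec f :=
    Partrec.nat_iff.1 (Partrec.rfindOpt (Primrec₂.to_comp primrec_searchResult))
  have hdom : ∀ τ ∈ X, (f τ.code).Dom := by
    intro τ hτ
    refine Nat.rfindOpt_dom.2 ?_
    by_cases hs : Satisfiable τ
    · obtain ⟨M, hfin, hM⟩ := h τ hτ hs
      obtain ⟨k, m, T, hT⟩ := exists_isFiniteTable hfin hM
      refine ⟨encode ((k, m, T) : ℕ × ℕ × List Atom), ?_⟩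
      simp only [searchResult, encodek, Option.getD_some, hT, if_true]
      split <;> simp
    · obtain ⟨n, hn⟩ := (exists_refuted_iff_not_satisfiable τ).2 hs
      exact ⟨n, 0, by simp only [searchResult, if_pos hn]; rfl⟩
  -- The bound must be a total function on formulas; off `X` it takes an arbitrary value, unrelated
  -- to the search.
  have hval : ∀ τ : Formula ar, ∃ n, τ ∈ X → n ∈ f τ.code := fun τ => by
    by_cases hτ : τ ∈ X
    · exact ⟨_, fun _ => Part.get_mem (hdom τ hτ)⟩
    · exact ⟨0, fun h => absurd h hτ⟩
  choose s hs using hval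
  refine ⟨s, ⟨f, hf, fun τ hτ => Part.eq_some_iff.2 (hs τ hτ)⟩, fun τ hτ hsat => ?_⟩
  obtain ⟨w, hw⟩ := Nat.rfindOpt_spec (hs τ hτ)
  have hr : ¬∀ b ∈ allLists w 2, Refuted henkinConds τ.code w b := fun hr =>
    (exists_refuted_iff_not_satisfiable τ).1 ⟨w, hr⟩ hsat
  simp only [searchResult, if_neg hr] at hw
  split at hw
  · rename_i hT
    rw [← Option.some.inj hw]
    exact hT.exists_model
  · simp at hw

end IntFO

theorem mainTheorem3 {P : Type} [Primcodable P] (ar : P → ℕ) (har : Computable ar)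
    (X : Set (IntFO.Formula ar)) (hX : IntFO.Effective X) :
    IntFO.FiniteModelProperty X ↔ IntFO.SmallModelProperty X := by
  refine ⟨IntFO.FiniteModelProperty.smallModelProperty, ?_⟩
  rintro ⟨s, -, hs⟩ τ hτ hsat
  obtain ⟨M, hfin, -, hM⟩ := hs τ hτ hsat
  exact ⟨M, hfin, hM⟩
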